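/- A \emph{Carnot group} is a simply connected (finite-dimensional, real) Lie group $G$ together with a stratification $\mathfrak g=V_1\oplus\dots\oplus V_s$ of its Lie algebra, that is, a decomposition into vector subspaces with $V_{j+1}=[V_1,V_j]$ for $j=1,\dots,s$, where $V_{s+1}=\{0\}$, and a norm $|\cdot|$ on $V_1$. Let $\Delta\subset TG$ be the left-invariant distribution with $\Delta_e=V_1$, and extend $|\cdot|$ left-invariantly to $\Delta$. The length $L(\gamma)$ of a curve $\gamma:[a,b]\to G$ is $\int_a^b|\dot\gamma(t)|\,dt$ if $\gamma$ is absolutely continuous with $\dot\gamma\in\Delta$ almost everywhere, and $L(\gamma)=\infty$ otherwise. The Carnot--Carath\'eodory distance $d(g,h)$ is the infimum of the lengths of the curves from $g$ to $h$, and $\gamma:[a,b]\to G$ is \emph{length minimizing} if $L(\gamma)=d(\gamma(a),\gamma(b))$. A \emph{corner} in $G$ is a curve $\gamma:[-1,1]\to G$ of the form \[ \gamma(t)=\begin{cases}\exp(-tX_1)&\text{if }t\in[-1,0],\\ \exp(tX_2)&\text{if }t\in(0,1],\end{cases} \] where $X_1,X_2\in\mathfrak g$ are linearly independent. \textbf{Theorem.}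 Let $G$ be a Carnot group whose norm on $V_1$ is strictly convex (if $|x|=|y|=1$ and $|x+y|=2$, then $x=y$). Then no corner in $G$ is length minimizing. -/

import Mathlib

open Set MeasureTheory Manifold
open scoped ContDiff ENNReal Topology

noncomputable section

namespace Carnot

variable {E : Type*} [NormedAddCommGroup E] [NormedSpace ℝ E]
  {G : Type*} [TopologicalSpace G] [ChartedSpace E G] [Group G]

/-! ### The exponential map of a Lie group -/

/-- Left-invariant vector fields are invariant under left translations. -/
theorem mfderiv_mul_left_mulInvariantVectorField [LieGroup 𝓘(ℝ, E) ∞ G]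
    (X : GroupLieAlgebra 𝓘(ℝ, E) G) (g h : G) :
    mfderiv 𝓘(ℝ, E) 𝓘(ℝ, E) (fun x : G => g * x) h (mulInvariantVectorField X h) =
      mulInvariantVectorField X (g * h) := by
  have hd : ∀ (a x : G), MDifferentiableAt 𝓘(ℝ, E) 𝓘(ℝ, E) (fun y : G => a * y) x := fun a x =>
    (contMDiff_mul_left (I := 𝓘(ℝ, E)) (n := ∞) (a := a)).contMDiffAt.mdifferentiableAt (by simp)
  have hcomp : (fun x : G => g * h * x) = (fun x : G => g * x) ∘ (fun x : G => h * x) := by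
    funext x
    simp [mul_assoc]
  have key := mfderiv_comp_of_eq (I := 𝓘(ℝ, E)) (I' := 𝓘(ℝ, E)) (I'' := 𝓘(ℝ, E))
    (f := fun x : G => h * x) (g := fun x : G => g * x) (x := (1 : G)) (y := h)
    (hd g h) (hd h 1) (by simp)
  unfold mulInvariantVectorField
  rw [hcomp, key]
  have hk : ∀ (k : G) (v : E), k = h →
      (mfderiv 𝓘(ℝ, E) 𝓘(ℝ, E) (fun x : G => g * x) h : E →L[ℝ] E) v =
        (mfderiv 𝓘(ℝ, E) 𝓘(ℝ, E) (fun x : G => g * x) k : E →L[ℝ] E) v := by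
    rintro k v rfl
    rfl
  exact hk (h * 1) _ (mul_one h)

/-- Every left-invariant vector field on a Lie group has a global integral curve through the
identity. -/
theorem exists_isMIntegralCurve_mulInvariantVectorField [FiniteDimensional ℝ E]
    [LieGroup 𝓘(ℝ, E) ∞ G] [T2Space G] (X : GroupLieAlgebra 𝓘(ℝ, E) G) :
    ∃ c : ℝ → G, c 0 = 1 ∧
      IsMIntegralCurve (I := 𝓘(ℝ, E)) c (fun g => mulInvariantVectorField X g) := by
  have : CompleteSpace E := FiniteDimensional.complete ℝ E
  have : LieGroup 𝓘(ℝ, E) (minSmoothness ℝ 3) G :=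
    LieGroup.of_le (n := ∞) (by
      rw [minSmoothness_of_isRCLikeNormedField]
      exact ENat.LEInfty.out)
  have : IsManifold 𝓘(ℝ, E) ∞ G := ContMDiffMul.toIsManifold
  have : IsManifold 𝓘(ℝ, E) 1 G := IsManifold.of_le (n := ∞) (by simp)
  have hv : ContMDiff 𝓘(ℝ, E) 𝓘(ℝ, E).tangent 1
      (fun g : G => (⟨g, mulInvariantVectorField X g⟩ : TangentBundle 𝓘(ℝ, E) G)) :=
    (contMDiff_mulInvariantVectorField X).of_le (by simp)
  obtain ⟨c, hc0, hc⟩ := exists_isMIntegralCurveAt_of_contMDiffAt_boundaryless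
    (t₀ := (0 : ℝ)) (hv 1)
  obtain ⟨ε, hε, hc⟩ := isMIntegralCurveAt_iff'.mp hc
  rw [Real.ball_eq_Ioo, zero_sub, zero_add] at hc
  refine exists_isMIntegralCurve_of_isMIntegralCurveOn hv hε (fun g => ?_) 1
  refine ⟨fun t => g * c t, by simp [hc0], fun t ht => ?_⟩
  have hd : MDifferentiableAt 𝓘(ℝ, E) 𝓘(ℝ, E) (fun y : G => g * y) (c t) :=
    (contMDiff_mul_left (I := 𝓘(ℝ, E)) (n := ∞) (a := g)).contMDiffAt.mdifferentiableAt (by simp)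
  have h := hd.hasMFDerivAt.comp_hasMFDerivWithinAt t (hc t ht)
  rw [← mfderiv_mul_left_mulInvariantVectorField]
  refine h.congr_mfderiv (ContinuousLinearMap.ext fun r => ?_)
  exact ContinuousLinearMap.map_smul
    (mfderiv 𝓘(ℝ, E) 𝓘(ℝ, E) (fun y : G => g * y) (c t) : E →L[ℝ] E) (r : ℝ)
    (mulInvariantVectorField X (c t) : E)

/-- The exponential map: `exp X = c 1`, where `c` is the integral curve, starting at the identity,
of the left-invariant vector field equal to `X` at the identity. -/
def lieExp [FiniteDimensional ℝ E] [LieGroup 𝓘(ℝ, E) ∞ G] [T2Space G]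
    (X : GroupLieAlgebra 𝓘(ℝ, E) G) : G :=
  (exists_isMIntegralCurve_mulInvariantVectorField X).choose 1

/-- The curve `γ : [-1, 1] → G` (given by its extension to `ℝ` by arbitrary values) is a corner:
`γ t = exp (-t X₁)` on `[-1, 0]` and `γ t = exp (t X₂)` on `(0, 1]`, for some linearly independent
`X₁, X₂` in the Lie algebra of `G`. -/
def IsCorner [FiniteDimensional ℝ E] [LieGroup 𝓘(ℝ, E) ∞ G] [T2Space G] (γ : ℝ → G) : Prop :=
  ∃ X₁ X₂ : GroupLieAlgebra 𝓘(ℝ, E) G, LinearIndependent ℝ ![X₁, X₂] ∧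
    (∀ t ∈ Icc (-1 : ℝ) 0, γ t = lieExp ((-t) • X₁)) ∧
    (∀ t ∈ Ioc (0 : ℝ) 1, γ t = lieExp (t • X₂))

/-! ### Absolutely continuous curves -/

/-- `γ : [a, b] → G` is absolutely continuous: it is continuous, and, read in any chart, it is
absolutely continuous on every subinterval that `γ` maps into the domain of that chart. -/
def AbsCont (E : Type*) [NormedAddCommGroup E] {G : Type*} [TopologicalSpace G] [ChartedSpace E G]
    (γ : ℝ → G) (a b : ℝ) : Prop :=
  ContinuousOn γ (Icc a b) ∧
    ∀ (x : G) (c d : ℝ), a ≤ c → c ≤ d → d ≤ b → MapsTo γ (Icc c d) (chartAt E x).source →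
      AbsolutelyContinuousOnInterval (fun t => chartAt E x (γ t)) c d

/-! ### Carnot groups -/

variable (E G) in
/-- The data that make a simply connected Lie group `G` a Carnot group: a stratification
`V₁ ⊕ ⋯ ⊕ V_s` of its Lie algebra, with `V_{j+1} = [V₁, V_j]` for all `j ≥ 1` and
`V_j = 0` for `j > s`, and a norm on the first layer `V₁`.
The layers are indexed by `ℕ`, the value at the unused index `0` being the zero subspace. -/
structure CarnotStructure where
  /-- the number of layers -/
  step : ℕ
  /-- the layers `V_j` -/
  layer : ℕ → Submodule ℝ (GroupLieAlgebra 𝓘(ℝ, E) G)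
  layer_zero : layer 0 = ⊥
  layer_of_step_lt : ∀ j, step < j → layer j = ⊥
  isInternal : DirectSum.IsInternal layer
  layer_succ : ∀ j, 1 ≤ j → layer (j + 1) =
    Submodule.span ℝ {Z | ∃ X ∈ layer 1, ∃ Y ∈ layer j, Z = ⁅X, Y⁆}
  /-- the norm on the first layer -/
  norm : Seminorm ℝ (layer 1)
  eq_zero_of_norm_eq_zero : ∀ X, norm X = 0 → X = 0

namespace CarnotStructure

variable (C : CarnotStructure E G)

/-- The norm on the first layer is strictly convex. -/
def IsStrictlyConvex : Prop :=
  ∀ X Y : C.layer 1, C.norm X = 1 → C.norm Y = 1 → C.norm (X + Y) = 2 → X = Y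

/-- The distribution `Δ`: at `g`, the left translate to `g` of the first layer. -/
def distribution (g : G) : Set (TangentSpace 𝓘(ℝ, E) g) :=
  {v | ∃ X : C.layer 1, mulInvariantVectorField (X : GroupLieAlgebra 𝓘(ℝ, E) G) g = v}

/-- The left-invariant extension of the norm to `Δ`, with value `∞` outside of `Δ`. (For `v` in `Δ`
at `g`, there is exactly one `X` in the infimum.) -/
def speed (g : G) (v : TangentSpace 𝓘(ℝ, E) g) : ℝ≥0∞ :=
  ⨅ (X : C.layer 1) (_ : mulInvariantVectorField (X : GroupLieAlgebra 𝓘(ℝ, E) G) g = v),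
    ENNReal.ofReal (C.norm X)

open scoped Classical in
/-- The length of `γ : [a, b] → G`: the integral of the norm of `γ'` if `γ` is absolutely continuous
with `γ'` in `Δ` almost everywhere, and `∞` otherwise. -/
def length (γ : ℝ → G) (a b : ℝ) : ℝ≥0∞ :=
  if AbsCont E γ a b ∧ ∀ᵐ t ∂(volume.restrict (Icc a b)),
      mfderiv 𝓘(ℝ, ℝ) 𝓘(ℝ, E) γ t 1 ∈ C.distribution (γ t) then
    ∫⁻ t in Icc a b, C.speed (γ t) (mfderiv 𝓘(ℝ, ℝ) 𝓘(ℝ, E) γ t 1)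
  else ∞

/-- The Carnot–Carathéodory distance: the infimum of the lengths of the curves from `g` to `h`. -/
def ccDist (g h : G) : ℝ≥0∞ :=
  ⨅ (γ : ℝ → G) (a : ℝ) (b : ℝ) (_ : a ≤ b) (_ : γ a = g) (_ : γ b = h), C.length γ a b

/-- The curve `γ : [a, b] → G` is length minimizing: its length is the distance between its
endpoints. -/
def IsLengthMinimizing (γ : ℝ → G) (a b : ℝ) : Prop :=
  C.length γ a b = C.ccDist (γ a) (γ b)

end CarnotStructure

end Carnot

end

/-!
# Corners are not length minimizing

Let `X₁`, `X₂` be the directions of a corner. If its length is finite, both are horizontal, and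
the length is at least `|X₁| + |X₂|` (`mem_layer_and_le_length`). Strict convexity gives
`|X₂ - X₁| < |X₁| + |X₂|`: up to terms of degree `2`, the segment `X₂ - X₁` is a shortcut between
the endpoints `exp X₁` and `exp X₂`. It remains to correct the endpoint of the shortcut in degrees
`2, 3, …` without losing the gain.

All curves are *words*: concatenations of one-parameter groups of horizontal vectors. A word `w`
that closes the corner up to degree `k` with an error of degree `k + 1` is improved as follows
(`exists_shorter_word_mod`). A copy of `w` dilated by a small factor `ε` cuts the tip of the
corner; this gains a length proportional to `ε` and leaves an error of size `ε ^ (k + 1)` in degree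
`k + 1`. As the error is in the Lie algebra generated by `X₁` and `X₂`, it is a sum
`[X₁, a] + [X₂, b]` with `a`, `b` of degree `k`, and is removed by conjugating the remaining sides
of the corner with words that represent multiples of `a` and `b` of size `ε ^ (k + 1)`. These words
have length of order `ε ^ ((k + 1) / k)`, which is less than the gain for small `ε`. After finitely
many steps the word closes up exactly (`exists_shorter_word`).

This computation needs no Baker–Campbell–Hausdorff formula in the group. It is carried out with
exponentials of nilpotent elements in an associative algebra with a filtration, a grading element
and dilations (`DilationFiltration`); leading terms of words lie in the generated Lie algebra because
conjugation by a word moves the grading element by an element of this Lie algebra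
(`Adapted.exists_lead`). The algebra used is the endomorphism algebra of `𝔤 ⊕ ℝδ`, where `δ` is the
grading derivation: `𝔤` acts faithfully on it (`Stratification.endFiltration`).

A relation between words in this algebra is transferred to the group (`prod_lieExp_eq_one`). By the
product rule, the velocity of `s ↦ ∏ exp (e^{j s} Yⱼ)` is read off from the action of the product on
`δ`. It vanishes if the relation holds in the algebra, so the product in the group does not depend
on `s`, and it tends to `1` as `s → -∞`. This rests on `Ad (exp Y) = e^{ad Y}`, for which the
derivative of `Ad` at the identity is computed in a chart (`hasDerivAt_Ad_zero`).

Finally, a corner of infinite length is not minimizing, as its endpoints are at finite distance: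
every `exp X` is a product of exponentials of horizontal vectors. For homogeneous `X` this is again
transferred from the algebra; in general, `exp (t X)` is factored along a chain of ideals
(`isIntegrable_top`).
-/

noncomputable section

namespace Carnot

/-! ### The exponential of a nilpotent element of a real algebra -/

section NilExp

variable {R : Type*} [Ring R] [Algebra ℝ R]

/-- The exponential of a nilpotent element of a real algebra: `IsNilpotent.exp`, for the
`ℚ`-module structure obtained by restriction of scalars. -/
def nilExp (y : R) : R :=
  letI : Module ℚ R := Module.compHom R (algebraMap ℚ ℝ)
  IsNilpotent.exp y

theorem nilExp_eq_sum {y : R} {n : ℕ} (h : y ^ n = 0) :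
    nilExp y = ∑ i ∈ Finset.range n, (i.factorial : ℝ)⁻¹ • y ^ i := by
  let _ : Module ℚ R := Module.compHom R (algebraMap ℚ ℝ)
  refine (IsNilpotent.exp_eq_sum h).trans (Finset.sum_congr rfl fun i _ => ?_)
  rw [← Rat.cast_smul_eq_qsmul ℝ]
  simp

theorem nilExp_add {a b : R} (h : Commute a b) (ha : IsNilpotent a) (hb : IsNilpotent b) :
    nilExp (a + b) = nilExp a * nilExp b :=
  letI : Module ℚ R := Module.compHom R (algebraMap ℚ ℝ)
  IsNilpotent.exp_add_of_commute h ha hb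

theorem nilExp_mul_neg {a : R} (ha : IsNilpotent a) : nilExp a * nilExp (-a) = 1 :=
  letI : Module ℚ R := Module.compHom R (algebraMap ℚ ℝ)
  IsNilpotent.exp_mul_exp_neg_self ha

theorem nilExp_neg_mul {a : R} (ha : IsNilpotent a) : nilExp (-a) * nilExp a = 1 :=
  letI : Module ℚ R := Module.compHom R (algebraMap ℚ ℝ)
  IsNilpotent.exp_neg_mul_exp_self ha

theorem map_nilExp {R' : Type*} [Ring R'] [Algebra ℝ R'] {a : R} (ha : IsNilpotent a)
    (f : R →ₐ[ℝ] R') : f (nilExp a) = nilExp (f a) := by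
  obtain ⟨n, hn⟩ := ha
  rw [nilExp_eq_sum hn, nilExp_eq_sum (n := n) (by rw [← map_pow, hn, map_zero]), map_sum]
  simp

/-- `e^y x = (e^{ad y} x) e^y`, with a truncated series for `e^{ad y}`. -/
theorem exists_nilExp_mul_eq {y : R} (hy : IsNilpotent y) :
    ∃ n, ∀ x : R, nilExp y * x =
      (∑ i ∈ Finset.range (n + 1), (i.factorial : ℝ)⁻¹ • ((fun z => y * z - z * y)^[i] x)) *
        nilExp y := by
  obtain ⟨n, hn⟩ := hy
  have hl : LinearMap.mulLeft ℝ y ^ n = 0 := by rw [LinearMap.pow_mulLeft, hn]; ext; simp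
  have hr : LinearMap.mulRight ℝ (-y) ^ n = 0 := by
    rw [LinearMap.pow_mulRight, neg_pow, hn]; ext; simp
  have hc : Commute (LinearMap.mulLeft ℝ y) (LinearMap.mulRight ℝ (-y)) :=
    LinearMap.commute_mulLeft_right y (-y)
  obtain ⟨m, hm⟩ := hc.isNilpotent_add ⟨n, hl⟩ ⟨n, hr⟩
  refine ⟨m, fun x => ?_⟩
  have hm' : (LinearMap.mulLeft ℝ y + LinearMap.mulRight ℝ (-y)) ^ (m + 1) = 0 := by
    rw [pow_succ, hm, zero_mul]
  have hL : nilExp (LinearMap.mulLeft ℝ y) = LinearMap.mulLeft ℝ (nilExp y) := by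
    rw [nilExp_eq_sum hl, nilExp_eq_sum hn]
    ext z
    simp [LinearMap.pow_mulLeft, LinearMap.sum_apply, Finset.sum_mul]
  have hR : nilExp (LinearMap.mulRight ℝ (-y)) = LinearMap.mulRight ℝ (nilExp (-y)) := by
    rw [nilExp_eq_sum hr, nilExp_eq_sum (y := -y) (n := n) (by rw [neg_pow, hn, mul_zero])]
    ext z
    simp [LinearMap.pow_mulRight, LinearMap.sum_apply, Finset.mul_sum]
  have hit : ∀ i, ((LinearMap.mulLeft ℝ y + LinearMap.mulRight ℝ (-y)) ^ i) x =
      (fun z => y * z - z * y)^[i] x := fun i => by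
    rw [Module.End.pow_apply]
    congr 2
    ext z
    simp [sub_eq_add_neg]
  have key := congrArg (fun f : Module.End ℝ R => f x) (nilExp_add hc ⟨n, hl⟩ ⟨n, hr⟩)
  rw [nilExp_eq_sum hm', hL, hR] at key
  simp only [LinearMap.sum_apply, LinearMap.smul_apply, hit, Module.End.mul_apply,
    LinearMap.mulRight_apply, LinearMap.mulLeft_apply] at key
  rw [key, mul_assoc, mul_assoc, nilExp_neg_mul ⟨n, hn⟩, mul_one]

end NilExp

/-! ### Filtered algebras with dilations -/

/-- A decreasing multiplicative filtration of a real algebra that ends at `0`, an element `D` such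
that `[D, ·]` acts on each quotient `fil k / fil (k + 1)` as multiplication by `k`, and a family of
algebra endomorphisms, the dilations, that preserve the filtration. -/
structure DilationFiltration (R : Type*) [Ring R] [Algebra ℝ R] where
  /-- the filtration -/
  fil : ℕ → Submodule ℝ R
  /-- an index at which the filtration vanishes -/
  bound : ℕ
  anti : Antitone fil
  one_mem : 1 ∈ fil 0
  mul_mem : ∀ {i j a b}, a ∈ fil i → b ∈ fil j → a * b ∈ fil (i + j)
  fil_bound : fil bound = ⊥
  /-- the grading element -/
  D : R
  comm_D : ∀ {k x}, x ∈ fil k → D * x - x * D - (k : ℝ) • x ∈ fil (k + 1)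
  /-- the dilations -/
  dil : ℝ → R →ₐ[ℝ] R
  dil_mem : ∀ {k x r}, x ∈ fil k → dil r x ∈ fil k

section Layers

variable {R : Type*} [Ring R] [Algebra ℝ R]

/-- The iterated commutators of a subspace `A`: `A` itself in degree `1`, and the span of the
commutators of `A` with degree `k` in degree `k + 1`. -/
def lieLayer (A : Submodule ℝ R) : ℕ → Submodule ℝ R
  | 0 => ⊥
  | 1 => A
  | k + 2 => Submodule.span ℝ {z | ∃ x ∈ A, ∃ y ∈ lieLayer A (k + 1), z = x * y - y * x}

theorem lieLayer_succ (A : Submodule ℝ R) {k : ℕ} (hk : 1 ≤ k) :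
    lieLayer A (k + 1) =
      Submodule.span ℝ {z | ∃ x ∈ A, ∃ y ∈ lieLayer A k, z = x * y - y * x} := by
  obtain ⟨k, rfl⟩ := Nat.exists_eq_add_of_le' hk
  rfl

theorem comm_mem_lieLayer (A : Submodule ℝ R) : ∀ {i j : ℕ} {x y : R}, x ∈ lieLayer A i →
    y ∈ lieLayer A j → x * y - y * x ∈ lieLayer A (i + j) := by
  have h1 : ∀ {j : ℕ} {x y : R}, x ∈ A → y ∈ lieLayer A j →
      x * y - y * x ∈ lieLayer A (j + 1) := by
    intro j x y hx hy
    rcases Nat.eq_zero_or_pos j with rfl | hj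
    · have : y = 0 := by simpa [lieLayer] using hy
      simp [this]
    · rw [lieLayer_succ A hj]
      exact Submodule.subset_span ⟨x, hx, y, hy, rfl⟩
  intro i
  induction i with
  | zero =>
    intro j x y hx hy
    have : x = 0 := by simpa [lieLayer] using hx
    simp [this]
  | succ i ih =>
    intro j x y hx hy
    rcases Nat.eq_zero_or_pos i with rfl | hi
    · rw [zero_add, add_comm]
      exact h1 hx hy
    rw [lieLayer_succ A hi] at hx
    induction hx using Submodule.span_induction with
    | mem z hz =>
      obtain ⟨a, ha, b, hb, rfl⟩ := hz
      have e1 : a * (b * y - y * b) - (b * y - y * b) * a ∈ lieLayer A (i + 1 + j) := by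
        have := h1 ha (ih hb hy)
        rwa [show i + j + 1 = i + 1 + j by ring] at this
      have e2 : b * (a * y - y * a) - (a * y - y * a) * b ∈ lieLayer A (i + 1 + j) := by
        have := ih hb (h1 ha hy)
        rwa [show i + (j + 1) = i + 1 + j by ring] at this
      have := Submodule.sub_mem _ e1 e2
      convert this using 1
      noncomm_ring
    | zero => simp
    | add z w _ _ hz hw =>
      have := Submodule.add_mem _ hz hw
      convert this using 1
      noncomm_ring
    | smul c z _ hz =>
      have := Submodule.smul_mem _ c hz
      convert this using 1
      rw [smul_sub, smul_mul_assoc, mul_smul_comm]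

/-- The span of all iterated commutators of `A`, a Lie subalgebra. -/
def lieSum (A : Submodule ℝ R) : Submodule ℝ R := ⨆ j, lieLayer A j

theorem lieLayer_le_lieSum (A : Submodule ℝ R) (j : ℕ) : lieLayer A j ≤ lieSum A :=
  le_iSup (lieLayer A) j

theorem comm_mem_lieSum (A : Submodule ℝ R) {x y : R} {i : ℕ} (hx : x ∈ lieLayer A i)
    (hy : y ∈ lieSum A) : x * y - y * x ∈ lieSum A := by
  induction hy using Submodule.iSup_induction' with
  | mem j y hy => exact lieLayer_le_lieSum A _ (comm_mem_lieLayer A hx hy)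
  | zero => simp
  | add y z _ _ hy hz =>
    have := Submodule.add_mem _ hy hz
    convert this using 1
    noncomm_ring

end Layers

namespace DilationFiltration

variable {R : Type*} [Ring R] [Algebra ℝ R] (Φ : DilationFiltration R)

/-- The elements of degree `k`, for the grading element and for the dilations. -/
def homog (k : ℕ) : Submodule ℝ R where
  carrier := {x | x ∈ Φ.fil k ∧ Φ.D * x - x * Φ.D = (k : ℝ) • x ∧
    ∀ r, r ≠ 0 → Φ.dil r x = r ^ k • x}
  zero_mem' := by simp
  add_mem' := by
    rintro a b ⟨ha, ha', ha''⟩ ⟨hb, hb', hb''⟩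
    refine ⟨add_mem ha hb, ?_, fun r hr => ?_⟩
    · rw [smul_add, ← ha', ← hb']
      noncomm_ring
    · rw [map_add, ha'' r hr, hb'' r hr, smul_add]
  smul_mem' := by
    rintro c a ⟨ha, ha', ha''⟩
    refine ⟨Submodule.smul_mem _ _ ha, ?_, fun r hr => ?_⟩
    · rw [mul_smul_comm, smul_mul_assoc, ← smul_sub, ha', smul_comm]
    · rw [map_smul, ha'' r hr, smul_comm]

variable {Φ}

theorem comm_mem_fil {i j : ℕ} {x y : R} (hx : x ∈ Φ.fil i) (hy : y ∈ Φ.fil j) :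
    x * y - y * x ∈ Φ.fil (i + j) :=
  sub_mem (Φ.mul_mem hx hy) (add_comm i j ▸ Φ.mul_mem hy hx)

theorem comm_mem_homog {i j : ℕ} {x y : R} (hx : x ∈ Φ.homog i) (hy : y ∈ Φ.homog j) :
    x * y - y * x ∈ Φ.homog (i + j) := by
  obtain ⟨hx, hx', hx''⟩ := hx
  obtain ⟨hy, hy', hy''⟩ := hy
  refine ⟨comm_mem_fil hx hy, ?_, fun r hr => ?_⟩
  · have e : Φ.D * (x * y - y * x) - (x * y - y * x) * Φ.D =
        ((Φ.D * x - x * Φ.D) * y - y * (Φ.D * x - x * Φ.D)) +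
        (x * (Φ.D * y - y * Φ.D) - (Φ.D * y - y * Φ.D) * x) := by noncomm_ring
    rw [e, hx', hy']
    push_cast
    simp only [smul_mul_assoc, mul_smul_comm, ← smul_sub, add_smul]
  · simp only [map_sub, map_mul, hx'' r hr, hy'' r hr, smul_mul_assoc, mul_smul_comm, smul_smul, smul_sub,
      pow_add, mul_comm (r ^ i)]

theorem lieLayer_le_homog {A : Submodule ℝ R} (hA : A ≤ Φ.homog 1) :
    ∀ k, lieLayer A k ≤ Φ.homog k
  | 0 => bot_le
  | 1 => hA
  | k + 2 => by
    refine Submodule.span_le.2 ?_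
    rintro _ ⟨x, hx, y, hy, rfl⟩
    have := comm_mem_homog (hA hx) (lieLayer_le_homog hA (k + 1) hy)
    rwa [show 1 + (k + 1) = k + 2 by ring] at this

theorem pow_mem_fil {k : ℕ} {x : R} (hx : x ∈ Φ.fil k) (n : ℕ) : x ^ n ∈ Φ.fil (n * k) := by
  induction n with
  | zero => simpa using Φ.one_mem
  | succ n ih => rw [pow_succ, add_mul, one_mul]; exact Φ.mul_mem ih hx

theorem pow_eq_zero {k n : ℕ} (hk : 1 ≤ k) {x : R} (hx : x ∈ Φ.fil k) (hn : Φ.bound ≤ n) :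
    x ^ n = 0 := by
  have h := Φ.anti (hn.trans (Nat.le_mul_of_pos_right n hk)) (pow_mem_fil hx n)
  simpa [Φ.fil_bound] using h

theorem isNilpotent {k : ℕ} (hk : 1 ≤ k) {x : R} (hx : x ∈ Φ.fil k) : IsNilpotent x :=
  ⟨_, pow_eq_zero hk hx le_rfl⟩

/-- A homogeneous element that lies deeper in the filtration than its degree vanishes. -/
theorem eq_zero_of_mem_homog {k : ℕ} {x : R} (hx : x ∈ Φ.homog k) (hx' : x ∈ Φ.fil (k + 1)) :
    x = 0 := by
  have h : ∀ m, x ∈ Φ.fil (k + 1 + m) := by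
    intro m
    induction m with
    | zero => exact hx'
    | succ m ih =>
      have := Φ.comm_D ih
      rw [hx.2.1, ← sub_smul] at this
      have h2 := Submodule.smul_mem _ (-(m + 1 : ℝ)⁻¹) this
      rw [smul_smul] at h2
      have : (m + 1 : ℝ) ≠ 0 := by positivity
      have e : -(m + 1 : ℝ)⁻¹ * ((k : ℝ) - ((k + 1 + m : ℕ) : ℝ)) = 1 := by
        push_cast
        field_simp
        ring
      rwa [e, one_smul] at h2
  have := Φ.anti (show Φ.bound ≤ k + 1 + Φ.bound by omega) (h Φ.bound)
  simpa [Φ.fil_bound] using this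

theorem nilExp_sub_mem {k : ℕ} (hk : 1 ≤ k) {x : R} (hx : x ∈ Φ.fil k) :
    nilExp x - 1 - x ∈ Φ.fil (k + 1) := by
  rw [nilExp_eq_sum (pow_eq_zero hk hx (Nat.le_add_right Φ.bound 2)), Finset.sum_range_succ',
    Finset.sum_range_succ']
  simp only [zero_add, Nat.factorial_zero, Nat.cast_one, inv_one, pow_zero, one_smul,
    Nat.factorial_one, pow_one, add_sub_cancel_right]
  refine Submodule.sum_mem _ fun i _ => Submodule.smul_mem _ _ ?_
  refine Φ.anti ?_ (pow_mem_fil hx (i + 1 + 1))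
  nlinarith

/-! ### Leading terms -/

variable (Φ) in
/-- `1 + z` is the leading part of `T`, up to terms of degree larger than `k`. -/
def Lead (k : ℕ) (T z : R) : Prop := z ∈ Φ.fil k ∧ T - 1 - z ∈ Φ.fil (k + 1)

namespace Lead

variable {i j k : ℕ} {T U T' U' z v : R}

theorem sub_one_mem (h : Φ.Lead k T z) : T - 1 ∈ Φ.fil k := by
  have := add_mem (Φ.anti (Nat.le_succ k) h.2) h.1
  simpa using this

theorem of_nilExp (hk : 1 ≤ k) (hz : z ∈ Φ.fil k) : Φ.Lead k (nilExp z) z :=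
  ⟨hz, nilExp_sub_mem hk hz⟩

theorem one : Φ.Lead k 1 0 := ⟨zero_mem _, by simp⟩

theorem mem_of_zero (h : Φ.Lead k T 0) : T - 1 ∈ Φ.fil (k + 1) := by simpa using h.2

theorem mul (hk : 1 ≤ k) (hT : Φ.Lead k T z) (hU : Φ.Lead k U v) :
    Φ.Lead k (T * U) (z + v) := by
  refine ⟨add_mem hT.1 hU.1, ?_⟩
  have h := Φ.anti (show k + 1 ≤ k + k by omega) (Φ.mul_mem hT.sub_one_mem hU.sub_one_mem)
  have := add_mem (add_mem hT.2 hU.2) h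
  convert this using 1
  noncomm_ring

/-- Conjugation by an element of `1 + fil 1` does not change the leading part. -/
theorem conj {V V' : R} (hT : Φ.Lead k T z) (hV : V - 1 ∈ Φ.fil 1) (hV' : V' - 1 ∈ Φ.fil 1)
    (h : V * V' = 1) : Φ.Lead k (V * T * V') z := by
  refine ⟨hT.1, ?_⟩
  have hV0 : V ∈ Φ.fil 0 := by
    simpa using add_mem (Φ.anti (Nat.zero_le 1) hV) Φ.one_mem
  have hV0' : V' ∈ Φ.fil 0 := by
    simpa using add_mem (Φ.anti (Nat.zero_le 1) hV') Φ.one_mem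
  have e1 : V * (T - 1 - z) * V' ∈ Φ.fil (k + 1) := by
    simpa using Φ.mul_mem (Φ.mul_mem hV0 hT.2) hV0'
  have e2 : (V - 1) * z * V' ∈ Φ.fil (k + 1) := by
    simpa [add_comm] using Φ.mul_mem (Φ.mul_mem hV hT.1) hV0'
  have e3 : z * (V' - 1) ∈ Φ.fil (k + 1) := Φ.mul_mem hT.1 hV'
  have := add_mem (add_mem e1 e2) e3
  convert this using 1
  calc V * T * V' - 1 - z = V * T * V' - V * V' - z := by rw [h]
    _ = _ := by noncomm_ring

/-- The leading part of a commutator is the commutator of the leading parts. -/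
theorem comm (hT : Φ.Lead i T z) (hU : Φ.Lead j U v) (hT' : T' - 1 ∈ Φ.fil 1)
    (hU' : U' - 1 ∈ Φ.fil 1) (hTT : T * T' = 1) (hUU : U * U' = 1) :
    Φ.Lead (i + j) (T * U * T' * U') (z * v - v * z) := by
  refine ⟨comm_mem_fil hT.1 hU.1, ?_⟩
  have hP : T' * U' - 1 ∈ Φ.fil 1 := by
    have h2 := Φ.anti (show 1 ≤ 1 + 1 by omega) (Φ.mul_mem hT' hU')
    convert add_mem h2 (add_mem hT' hU') using 1
    noncomm_ring
  have hP0 : T' * U' ∈ Φ.fil 0 := by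
    simpa using add_mem (Φ.anti (Nat.zero_le 1) hP) Φ.one_mem
  have e1 : (T - 1 - z) * (U - 1) - (U - 1) * (T - 1 - z) ∈ Φ.fil (i + j + 1) := by
    have := comm_mem_fil hT.2 hU.sub_one_mem
    rwa [show i + 1 + j = i + j + 1 by ring] at this
  have e2 : z * (U - 1 - v) - (U - 1 - v) * z ∈ Φ.fil (i + j + 1) :=
    comm_mem_fil (i := i) (j := j + 1) hT.1 hU.2
  have e3 := Φ.mul_mem (add_mem e1 e2) hP0
  have e4 := Φ.mul_mem (comm_mem_fil hT.1 hU.1) hP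
  convert add_mem e3 e4 using 1
  have e5 : U * T * (T' * U') = 1 := by
    rw [mul_assoc, ← mul_assoc T, hTT, one_mul, hUU]
  calc T * U * T' * U' - 1 - (z * v - v * z)
      = T * U * (T' * U') - U * T * (T' * U') - (z * v - v * z) := by rw [e5, ← mul_assoc]
    _ = _ := by noncomm_ring

theorem inv (hT : Φ.Lead k T z) (hT' : T' - 1 ∈ Φ.fil 1) (h : T * T' = 1) :
    Φ.Lead k T' (-z) := by
  refine ⟨neg_mem hT.1, ?_⟩
  have h0 : T' ∈ Φ.fil 0 := by
    simpa using add_mem (Φ.anti (Nat.zero_le 1) hT') Φ.one_mem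
  have e1 := Φ.mul_mem hT.2 h0
  have e2 := Φ.mul_mem hT.1 hT'
  convert neg_mem (add_mem e1 e2) using 1
  calc T' - 1 - -z = T' - T * T' + z := by rw [h]; noncomm_ring
    _ = _ := by noncomm_ring

theorem dil {r : ℝ} (hr : r ≠ 0) (hT : Φ.Lead k T z) (hz : z ∈ Φ.homog k) :
    Φ.Lead k (Φ.dil r T) (r ^ k • z) := by
  refine ⟨Submodule.smul_mem _ _ hT.1, ?_⟩
  have := Φ.dil_mem (r := r) hT.2
  rwa [map_sub, map_sub, map_one, hz.2.2 r hr] at this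

end Lead

/-! ### Adapted elements and the existence of leading terms -/

variable (Φ) in
/-- Conjugation by `T` preserves the Lie algebra generated by `A`, and moves the grading element by
an element of this Lie algebra. -/
def Adapted (A : Submodule ℝ R) (T : R) : Prop :=
  (∃ d ∈ lieSum A, T * Φ.D = (Φ.D + d) * T) ∧ ∀ x ∈ lieSum A, ∃ x' ∈ lieSum A, T * x = x' * T

variable {A : Submodule ℝ R}

theorem Adapted.one : Φ.Adapted A 1 :=
  ⟨⟨0, zero_mem _, by simp⟩, fun x hx => ⟨x, hx, by simp⟩⟩

theorem Adapted.mul {T U : R} (hT : Φ.Adapted A T) (hU : Φ.Adapted A U) : Φ.Adapted A (T * U) := by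
  obtain ⟨⟨d, hd, hTd⟩, hT⟩ := hT
  obtain ⟨⟨e, he, hUe⟩, hU⟩ := hU
  refine ⟨?_, fun x hx => ?_⟩
  · obtain ⟨e', he', hTe⟩ := hT e he
    refine ⟨d + e', add_mem hd he', ?_⟩
    rw [mul_assoc, hUe, ← mul_assoc, mul_add, hTd, hTe]
    noncomm_ring
  · obtain ⟨y, hy, hy'⟩ := hU x hx
    obtain ⟨z, hz, hz'⟩ := hT y hy
    exact ⟨z, hz, by rw [mul_assoc, hy', ← mul_assoc, hz', mul_assoc]⟩

/-- Both properties are preserved because `e^y x = (e^{ad y} x) e^y`; for `x = D` all terms of the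
series but the first are iterated commutators of `y` with `[y, D] = -j y`. -/
theorem Adapted.nilExp (hA : A ≤ Φ.homog 1) {j : ℕ} (hj : 1 ≤ j) {y : R} (hy : y ∈ lieLayer A j) :
    Φ.Adapted A (nilExp y) := by
  have hyh := lieLayer_le_homog hA j hy
  obtain ⟨n, hn⟩ := exists_nilExp_mul_eq (isNilpotent hj hyh.1)
  have hit : ∀ x ∈ lieSum A, ∀ i, (fun z => y * z - z * y)^[i] x ∈ lieSum A := by
    intro x hx i
    induction i with
    | zero => exact hx
    | succ i ih =>
      rw [Function.iterate_succ_apply']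
      exact comm_mem_lieSum A hy ih
  refine ⟨⟨∑ i ∈ Finset.range n, ((i + 1).factorial : ℝ)⁻¹ •
      (fun z => y * z - z * y)^[i] (-((j : ℝ) • y)), ?_, ?_⟩, fun x hx => ⟨_, ?_, hn x⟩⟩
  · refine Submodule.sum_mem _ fun i _ => Submodule.smul_mem _ _ (hit _ ?_ i)
    exact neg_mem (Submodule.smul_mem _ _ (lieLayer_le_lieSum A j hy))
  · rw [hn, Finset.sum_range_succ', add_comm]
    have : y * Φ.D - Φ.D * y = -((j : ℝ) • y) := by rw [← hyh.2.1]; noncomm_ring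
    simp [Function.iterate_succ_apply, this]
  · exact Submodule.sum_mem _ fun i _ => Submodule.smul_mem _ _ (hit x hx i)

/-- The component of degree `k` of an element of the Lie algebra generated by `A` that lies in
`fil k`. -/
theorem exists_mem_lieLayer_of_mem_fil (hA : A ≤ Φ.homog 1) {k : ℕ} {d : R} (hd : d ∈ lieSum A)
    (hdk : d ∈ Φ.fil k) : ∃ z ∈ lieLayer A k, d - z ∈ Φ.fil (k + 1) := by
  have hle : ∀ m, (⨆ j, ⨆ (_ : m ≤ j), lieLayer A j) ≤ Φ.fil m := fun m =>
    iSup₂_le fun j hj => ((lieLayer_le_homog hA j).trans fun x hx => hx.1).trans (Φ.anti hj)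
  have hsplit : ∀ m x, x ∈ (⨆ j, ⨆ (_ : m ≤ j), lieLayer A j) → ∃ z ∈ lieLayer A m,
      x - z ∈ ⨆ j, ⨆ (_ : m + 1 ≤ j), lieLayer A j := by
    intro m x hx
    have : (⨆ j, ⨆ (_ : m ≤ j), lieLayer A j) ≤
        lieLayer A m ⊔ ⨆ j, ⨆ (_ : m + 1 ≤ j), lieLayer A j := by
      refine iSup₂_le fun j hj => ?_
      rcases hj.eq_or_lt with rfl | hj
      · exact le_sup_left
      · exact le_sup_of_le_right (le_iSup₂_of_le j hj le_rfl)
    obtain ⟨z, hz, y, hy, rfl⟩ := Submodule.mem_sup.1 (this hx)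
    exact ⟨z, hz, by simpa using hy⟩
  have hind : ∀ m, m ≤ k → d ∈ ⨆ j, ⨆ (_ : m ≤ j), lieLayer A j := by
    intro m
    induction m with
    | zero => intro _; simpa [lieSum] using hd
    | succ m ih =>
      intro hm
      obtain ⟨z, hz, hdz⟩ := hsplit m d (ih (by omega))
      have hz0 : z = 0 := by
        refine eq_zero_of_mem_homog (lieLayer_le_homog hA m hz) ?_
        have := sub_mem (Φ.anti hm hdk) (hle _ hdz)
        simpa using this
      simpa [hz0] using hdz
  obtain ⟨z, hz, hdz⟩ := hsplit k d (hind k le_rfl)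
  exact ⟨z, hz, hle _ hdz⟩

/-- The leading term of an adapted element `T` of `1 + fil k` is in the `k`-th layer: it is read off
from `[D, T]`. -/
theorem Adapted.exists_lead (hA : A ≤ Φ.homog 1) {T : R} (hT : Φ.Adapted A T) {k : ℕ} (hk : 1 ≤ k)
    (hTk : T - 1 ∈ Φ.fil k) : ∃ z ∈ lieLayer A k, Φ.Lead k T z := by
  obtain ⟨⟨d, hd, hTd⟩, -⟩ := hT
  have hd1 : d ∈ Φ.fil 1 := by
    have : lieSum A ≤ Φ.fil 1 := iSup_le fun j => by
      rcases Nat.eq_zero_or_pos j with rfl | hj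
      · exact bot_le
      · exact ((lieLayer_le_homog hA j).trans fun x hx => hx.1).trans (Φ.anti hj)
    exact this hd
  -- `[D, T - 1] = -d T`, so that `k (T - 1)` and `-d` agree up to terms of degree `k + 1`
  have hdN : d * (T - 1) ∈ Φ.fil (k + 1) := add_comm 1 k ▸ Φ.mul_mem hd1 hTk
  have hcomm := Φ.comm_D hTk
  have e : -d - (k : ℝ) • (T - 1) ∈ Φ.fil (k + 1) := by
    convert add_mem hcomm hdN using 1
    have : Φ.D * (T - 1) - (T - 1) * Φ.D = Φ.D * T - T * Φ.D := by noncomm_ring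
    rw [this, hTd]
    noncomm_ring
  have hdk : -d ∈ Φ.fil k := by
    have := add_mem (Φ.anti (Nat.le_succ k) e) (Submodule.smul_mem _ (k : ℝ) hTk)
    simpa using this
  obtain ⟨z, hz, hdz⟩ := exists_mem_lieLayer_of_mem_fil hA (neg_mem hd) hdk
  have hk0 : (k : ℝ) ≠ 0 := by positivity
  refine ⟨(k : ℝ)⁻¹ • z, Submodule.smul_mem _ _ hz,
    Submodule.smul_mem _ _ (lieLayer_le_homog hA k hz).1, ?_⟩
  convert Submodule.smul_mem _ (k : ℝ)⁻¹ (sub_mem hdz e) using 1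
  rw [sub_sub_sub_cancel_left, smul_sub, smul_smul, inv_mul_cancel₀ hk0, one_smul]

end DilationFiltration

/-! ### Words of exponentials -/

section Words

variable {R : Type*} [Ring R] [Algebra ℝ R] {P : Type*} [AddCommGroup P] [Module ℝ P]
  (ρ : P →ₗ[ℝ] R)

/-- The product of the exponentials of the letters of a word. -/
def wordExp (w : List P) : R := (w.map fun X => nilExp (ρ X)).prod

@[simp]
theorem wordExp_nil : wordExp ρ [] = 1 := rfl

@[simp]
theorem wordExp_cons (X : P) (w : List P) : wordExp ρ (X :: w) = nilExp (ρ X) * wordExp ρ w := by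
  simp [wordExp]

@[simp]
theorem wordExp_append (u w : List P) : wordExp ρ (u ++ w) = wordExp ρ u * wordExp ρ w := by
  simp [wordExp]

/-- The word that represents the inverse. -/
def wordInv (w : List P) : List P := (w.map fun X => -X).reverse

/-- The word with all letters multiplied by `r`. -/
def wordScale (r : ℝ) (w : List P) : List P := w.map fun X => r • X

/-- The length of a word for a seminorm on the letters. -/
def wordCost (p : Seminorm ℝ P) (w : List P) : ℝ := (w.map p).sum

@[simp]
theorem wordCost_nil (p : Seminorm ℝ P) : wordCost p [] = 0 := rfl

@[simp]
theorem wordCost_cons (p : Seminorm ℝ P) (X : P) (w : List P) :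
    wordCost p (X :: w) = p X + wordCost p w := by
  simp [wordCost]

@[simp]
theorem wordCost_append (p : Seminorm ℝ P) (u w : List P) :
    wordCost p (u ++ w) = wordCost p u + wordCost p w := by
  simp [wordCost]

@[simp]
theorem wordCost_inv (p : Seminorm ℝ P) (w : List P) : wordCost p (wordInv w) = wordCost p w := by
  simp [wordCost, wordInv, Function.comp_def]

theorem wordCost_nonneg (p : Seminorm ℝ P) (w : List P) : 0 ≤ wordCost p w := by
  refine List.sum_nonneg fun x hx => ?_
  obtain ⟨X, -, rfl⟩ := List.mem_map.1 hx
  exact apply_nonneg p X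

theorem wordCost_scale (p : Seminorm ℝ P) {r : ℝ} (hr : 0 ≤ r) (w : List P) :
    wordCost p (wordScale r w) = r * wordCost p w := by
  induction w with
  | nil => simp [wordCost, wordScale]
  | cons X w ih =>
    have : wordScale r (X :: w) = r • X :: wordScale r w := rfl
    rw [this, wordCost_cons, wordCost_cons, ih, map_smul_eq_mul, Real.norm_of_nonneg hr, mul_add]

variable {ρ} {Φ : DilationFiltration R} (hρ : LinearMap.range ρ ≤ Φ.homog 1)
include hρ

theorem letter_mem_homog (X : P) : ρ X ∈ Φ.homog 1 := hρ ⟨X, rfl⟩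

theorem isNilpotent_letter (X : P) : IsNilpotent (ρ X) :=
  DilationFiltration.isNilpotent le_rfl (letter_mem_homog hρ X).1

theorem lead_letter (X : P) : Φ.Lead 1 (nilExp (ρ X)) (ρ X) :=
  .of_nilExp le_rfl (letter_mem_homog hρ X).1

theorem wordExp_sub_one_mem (w : List P) : wordExp ρ w - 1 ∈ Φ.fil 1 := by
  suffices ∃ z, Φ.Lead 1 (wordExp ρ w) z from this.choose_spec.sub_one_mem
  induction w with
  | nil => exact ⟨0, .one⟩
  | cons X w ih =>
    obtain ⟨z, hz⟩ := ih
    rw [wordExp_cons]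
    exact ⟨_, (lead_letter hρ X).mul le_rfl hz⟩

theorem wordExp_mul_inv (w : List P) : wordExp ρ w * wordExp ρ (wordInv w) = 1 := by
  induction w with
  | nil => simp [wordInv]
  | cons X w ih =>
    have : wordInv (X :: w) = wordInv w ++ [-X] := by simp [wordInv]
    rw [this, wordExp_cons, wordExp_append, mul_assoc, ← mul_assoc (wordExp ρ w), ih, one_mul]
    simpa using nilExp_mul_neg (isNilpotent_letter hρ X)

theorem dil_wordExp {r : ℝ} (hr : r ≠ 0) (w : List P) :
    Φ.dil r (wordExp ρ w) = wordExp ρ (wordScale r w) := by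
  induction w with
  | nil => simp [wordScale]
  | cons X w ih =>
    have : wordScale r (X :: w) = r • X :: wordScale r w := rfl
    rw [this, wordExp_cons, wordExp_cons, map_mul, ih, map_nilExp (isNilpotent_letter hρ X),
      (letter_mem_homog hρ X).2.2 r hr, pow_one, map_smul]

theorem adapted_wordExp (w : List P) : Φ.Adapted (LinearMap.range ρ) (wordExp ρ w) := by
  induction w with
  | nil => exact .one
  | cons X w ih =>
    rw [wordExp_cons]
    exact (DilationFiltration.Adapted.nilExp hρ (j := 1) le_rfl ⟨X, rfl⟩).mul ih

/-- Every element of a layer is the leading term of a word: iterate group commutators. -/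
theorem exists_word_lead {k : ℕ} (hk : 1 ≤ k) {z : R} (hz : z ∈ lieLayer (LinearMap.range ρ) k) :
    ∃ w : List P, Φ.Lead k (wordExp ρ w) z := by
  induction k, hk using Nat.le_induction generalizing z with
  | base =>
    obtain ⟨X, rfl⟩ := hz
    exact ⟨[X], by simpa using lead_letter hρ X⟩
  | succ k hk ih =>
    rw [lieLayer_succ _ hk] at hz
    -- scalars are absorbed by the elements of the spanning set, so that sums suffice
    have hz' : z ∈ AddSubgroup.closure {z | ∃ x ∈ LinearMap.range ρ,
        ∃ y ∈ lieLayer (LinearMap.range ρ) k, z = x * y - y * x} := by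
      induction hz using Submodule.span_induction with
      | mem z hz => exact AddSubgroup.subset_closure hz
      | zero => exact zero_mem _
      | add _ _ _ _ h1 h2 => exact add_mem h1 h2
      | smul c z hzs hz =>
        clear hzs
        induction hz using AddSubgroup.closure_induction with
        | mem z hz =>
          obtain ⟨x, hx, y, hy, rfl⟩ := hz
          exact AddSubgroup.subset_closure ⟨c • x, Submodule.smul_mem _ _ hx, y, hy, by
            rw [smul_sub, smul_mul_assoc, mul_smul_comm]⟩
        | zero => simp
        | add _ _ _ _ h1 h2 => rw [smul_add]; exact add_mem h1 h2
        | neg _ _ h => rw [smul_neg]; exact neg_mem h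
    clear hz
    induction hz' using AddSubgroup.closure_induction with
    | mem z hz =>
      obtain ⟨_, ⟨X, rfl⟩, y, hy, rfl⟩ := hz
      obtain ⟨u, hu⟩ := ih hy
      refine ⟨[X] ++ u ++ wordInv [X] ++ wordInv u, ?_⟩
      rw [wordExp_append, wordExp_append, wordExp_append, add_comm k 1]
      exact DilationFiltration.Lead.comm (by simpa using lead_letter hρ X) hu
        (wordExp_sub_one_mem hρ _) (wordExp_sub_one_mem hρ _) (wordExp_mul_inv hρ _)
        (wordExp_mul_inv hρ _)
    | zero => exact ⟨[], .one⟩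
    | add _ _ _ _ h1 h2 =>
      obtain ⟨u, hu⟩ := h1
      obtain ⟨v, hv⟩ := h2
      exact ⟨u ++ v, by rw [wordExp_append]; exact hu.mul (by omega) hv⟩
    | neg _ _ h =>
      obtain ⟨u, hu⟩ := h
      exact ⟨wordInv u, hu.inv (wordExp_sub_one_mem hρ _) (wordExp_mul_inv hρ _)⟩

/-- The exponentials of the first layer generate the exponentials of all layers: leading terms are
corrected one degree after the other. -/
theorem exists_wordExp_eq_nilExp {j : ℕ} (hj : 1 ≤ j) {y : R}
    (hy : y ∈ lieLayer (LinearMap.range ρ) j) : ∃ w : List P, wordExp ρ w = nilExp y := by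
  have hyj := DilationFiltration.lieLayer_le_homog hρ j hy
  have hA := DilationFiltration.Adapted.nilExp hρ hj hy
  have key : ∀ k, ∃ w : List P, nilExp y * wordExp ρ w - 1 ∈ Φ.fil (k + 1) := by
    intro k
    induction k with
    | zero =>
      refine ⟨[], ?_⟩
      simpa using Φ.anti hj (DilationFiltration.Lead.of_nilExp hj hyj.1).sub_one_mem
    | succ k ih =>
      obtain ⟨w, hw⟩ := ih
      obtain ⟨z, hz, hl⟩ := (hA.mul (adapted_wordExp hρ w)).exists_lead hρ (by omega) hw
      obtain ⟨u, hu⟩ := exists_word_lead hρ (by omega) (neg_mem hz)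
      refine ⟨w ++ u, ?_⟩
      have := hl.mul (by omega) hu
      rw [add_neg_cancel] at this
      simpa [mul_assoc] using this.mem_of_zero
  obtain ⟨w, hw⟩ := key Φ.bound
  have h0 := Φ.anti (Nat.le_succ Φ.bound) hw
  rw [Φ.fil_bound, Submodule.mem_bot, sub_eq_zero] at h0
  refine ⟨wordInv w, ?_⟩
  calc wordExp ρ (wordInv w) = nilExp y * wordExp ρ w * wordExp ρ (wordInv w) := by
        rw [h0, one_mul]
    _ = nilExp y := by rw [mul_assoc, wordExp_mul_inv hρ, mul_one]

/-- The words through which a corner is shortened. With `p (x₂ - x₁) < p x₁ + p x₂`, the segment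
`x₂ - x₁` joins the endpoints of the corner up to terms of degree `2`. A shorter word that joins
them up to degree `k` is turned into one for degree `k + 1` by cutting the corner with the small
copy, at scale `ε = τ ^ k`, of this word; the error, of size `ε ^ (k + 1)` and degree `k + 1`, is
a sum of commutators of `x₁` and `x₂` with elements of degree `k`, hence is corrected by conjugating
the long sides of the corner with words at scale `η = τ ^ (k + 1)`, for `η ^ k = ε ^ (k + 1)`. The
length gained is proportional to `ε` and the length spent is proportional to `η = τ ε`. -/
theorem exists_shorter_word_mod (p : Seminorm ℝ P) {x₁ x₂ : P}
    (hspan : Submodule.span ℝ {x₁, x₂} = ⊤) (hp : p (x₂ - x₁) < p x₁ + p x₂) {k : ℕ}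
    (hk : 1 ≤ k) : ∃ w : List P, wordCost p w < p x₁ + p x₂ ∧
      wordExp ρ ([x₁] ++ w ++ [-x₂]) - 1 ∈ Φ.fil (k + 1) := by
  induction k, hk using Nat.le_induction with
  | base =>
    refine ⟨[x₂ - x₁], by simpa using hp, ?_⟩
    have h := ((lead_letter hρ x₁).mul le_rfl (lead_letter hρ (x₂ - x₁))).mul le_rfl
      (lead_letter hρ (-x₂))
    have e : ρ x₁ + ρ (x₂ - x₁) + ρ (-x₂) = 0 := by simp
    rw [e] at h
    simpa [mul_assoc] using h.mem_of_zero
  | succ k hk ih =>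
    obtain ⟨w, hw, hwk⟩ := ih
    obtain ⟨z, hz, hl⟩ := (adapted_wordExp hρ _).exists_lead hρ (by omega) hwk
    obtain ⟨a, ha, b, hb, hab⟩ : ∃ a ∈ lieLayer (LinearMap.range ρ) k,
        ∃ b ∈ lieLayer (LinearMap.range ρ) k,
          z = (ρ x₁ * a - a * ρ x₁) + (ρ x₂ * b - b * ρ x₂) := by
      rw [lieLayer_succ _ hk] at hz
      clear hl
      induction hz using Submodule.span_induction with
      | mem z hz =>
        obtain ⟨_, ⟨X, rfl⟩, y, hy, rfl⟩ := hz
        obtain ⟨c, d, rfl⟩ := Submodule.mem_span_pair.1 (hspan ▸ Submodule.mem_top : X ∈ _)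
        refine ⟨c • y, Submodule.smul_mem _ _ hy, d • y, Submodule.smul_mem _ _ hy, ?_⟩
        simp only [map_add, map_smul, smul_mul_assoc, mul_smul_comm, add_mul, mul_add]
        abel
      | zero => exact ⟨0, zero_mem _, 0, zero_mem _, by simp⟩
      | add z z' _ _ h h' =>
        obtain ⟨a, ha, b, hb, rfl⟩ := h
        obtain ⟨a', ha', b', hb', rfl⟩ := h'
        exact ⟨a + a', add_mem ha ha', b + b', add_mem hb hb', by noncomm_ring⟩
      | smul c z _ h =>
        obtain ⟨a, ha, b, hb, rfl⟩ := h
        refine ⟨c • a, Submodule.smul_mem _ _ ha, c • b, Submodule.smul_mem _ _ hb, ?_⟩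
        simp only [smul_add, smul_sub, smul_mul_assoc, mul_smul_comm]
    -- the factors `-2` and `2`: the words conjugate only the halves `x₁ / 2` and `x₂ / 2`
    obtain ⟨u, hu⟩ := exists_word_lead hρ hk (Submodule.smul_mem _ (-2 : ℝ) ha)
    obtain ⟨v, hv⟩ := exists_word_lead hρ hk (Submodule.smul_mem _ (2 : ℝ) hb)
    have hlay := DilationFiltration.lieLayer_le_homog hρ
    -- the scale `τ`
    obtain ⟨τ, hτ0, hτ1, hτ⟩ : ∃ τ : ℝ, 0 < τ ∧ τ ≤ 1 / 2 ∧
        2 * τ * (wordCost p u + wordCost p v) < p x₁ + p x₂ - wordCost p w := by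
      have hc : 0 < p x₁ + p x₂ - wordCost p w := by linarith
      have hu0 := wordCost_nonneg p u
      have hv0 := wordCost_nonneg p v
      refine ⟨min (1 / 2) ((p x₁ + p x₂ - wordCost p w) /
        (2 * (wordCost p u + wordCost p v + 1))), by positivity, min_le_left _ _, ?_⟩
      have h1 := min_le_right (1 / 2 : ℝ) ((p x₁ + p x₂ - wordCost p w) /
        (2 * (wordCost p u + wordCost p v + 1)))
      rw [le_div_iff₀ (by positivity)] at h1
      have h2 : 0 < min (1 / 2 : ℝ) ((p x₁ + p x₂ - wordCost p w) /
        (2 * (wordCost p u + wordCost p v + 1))) := by positivity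
      linarith
    -- from here on `ε = τ ^ k` and `η = τ ^ (k + 1)`
    have hε0 : 0 < τ ^ k := by positivity
    have hε1 : τ ^ k ≤ 1 / 2 := by
      refine le_trans ?_ hτ1
      simpa using pow_le_pow_of_le_one hτ0.le (by linarith) hk
    have hη : τ ^ (k + 1) = τ * τ ^ k := pow_succ' τ k
    have hη0 : 0 < τ ^ (k + 1) := by positivity
    have hηε : (τ ^ (k + 1)) ^ k = (τ ^ k) ^ (k + 1) := by rw [← pow_mul, ← pow_mul, mul_comm]
    generalize hε : τ ^ k = ε at *
    generalize τ ^ (k + 1) = η at *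
    have hu' : Φ.Lead k (wordExp ρ (wordScale η u)) (η ^ k • (-2 : ℝ) • a) := by
      rw [← dil_wordExp hρ hη0.ne']
      exact hu.dil hη0.ne' (hlay k (Submodule.smul_mem _ _ ha))
    have hv' : Φ.Lead k (wordExp ρ (wordScale η v)) (η ^ k • (2 : ℝ) • b) := by
      rw [← dil_wordExp hρ hη0.ne']
      exact hv.dil hη0.ne' (hlay k (Submodule.smul_mem _ _ hb))
    have hw' := hl.dil hε0.ne' (hlay _ hz)
    rw [dil_wordExp hρ hε0.ne'] at hw'
    set u' := wordScale η u
    set v' := wordScale η v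
    set w' := wordScale ε w
    have hsc : wordScale ε ([x₁] ++ w ++ [-x₂]) = [ε • x₁] ++ w' ++ [-(ε • x₂)] := by
      simp [wordScale, w']
    rw [hsc] at hw'
    have h1 := wordExp_sub_one_mem hρ
    have hinv : ∀ X : P, wordExp ρ [X] * wordExp ρ [-X] = 1 := fun X => by
      simpa [wordInv] using wordExp_mul_inv hρ [X]
    have hadd : ∀ (s t : ℝ) (X : P), wordExp ρ [s • X] * wordExp ρ [t • X] =
        wordExp ρ [(s + t) • X] := fun s t X => by
      have hc : Commute (ρ (s • X)) (ρ (t • X)) := by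
        simp only [map_smul]
        exact ((Commute.refl (ρ X)).smul_left s).smul_right t
      have := nilExp_add hc (isNilpotent_letter hρ _) (isNilpotent_letter hρ _)
      rw [← map_add, ← add_smul] at this
      simpa using this.symm
    have hlet : ∀ X : P, Φ.Lead 1 (wordExp ρ [X]) (ρ X) := fun X => by
      simpa using lead_letter hρ X
    refine ⟨u' ++ [-((1 / 2 : ℝ) • x₁)] ++ wordInv u' ++ [-((1 / 2 - ε) • x₁)] ++ w' ++
      [(1 / 2 - ε) • x₂] ++ v' ++ [(1 / 2 : ℝ) • x₂] ++ wordInv v', ?_, ?_⟩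
    · have n1 : p ((1 / 2 : ℝ) • x₁) = 1 / 2 * p x₁ := by
        rw [map_smul_eq_mul, Real.norm_of_nonneg (by norm_num)]
      have n2 : p ((1 / 2 : ℝ) • x₂) = 1 / 2 * p x₂ := by
        rw [map_smul_eq_mul, Real.norm_of_nonneg (by norm_num)]
      have n3 : p ((1 / 2 - ε) • x₁) = (1 / 2 - ε) * p x₁ := by
        rw [map_smul_eq_mul, Real.norm_of_nonneg (by linarith)]
      have n4 : p ((1 / 2 - ε) • x₂) = (1 / 2 - ε) * p x₂ := by
        rw [map_smul_eq_mul, Real.norm_of_nonneg (by linarith)]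
      simp only [wordCost_append, wordCost_cons, wordCost_nil, wordCost_inv, map_neg_eq_map, n1, n2,
        n3, n4, u', v', w', wordCost_scale p hη0.le, wordCost_scale p hε0.le]
      have := mul_lt_mul_of_pos_left hτ hε0
      rw [hη]
      nlinarith
    -- up to degree `k + 1`, the closed word is a product of three factors: the commutator of
    -- `x₁ / 2` with `u'`, the small copy of the old closed word, and the commutator of `v'` with
    -- `x₂ / 2`; their leading terms cancel
    · have c1 := ((hlet ((1 / 2 : ℝ) • x₁)).comm hu' (h1 [-((1 / 2 : ℝ) • x₁)])
        (h1 (wordInv u')) (hinv _) (wordExp_mul_inv hρ u')).conj (h1 [(1 / 2 : ℝ) • x₁])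
        (h1 [-((1 / 2 : ℝ) • x₁)]) (hinv _)
      have c2 := (hv'.comm (hlet ((1 / 2 : ℝ) • x₂)) (h1 (wordInv v'))
        (h1 [-((1 / 2 : ℝ) • x₂)]) (wordExp_mul_inv hρ v') (hinv _)).conj (h1 [(1 / 2 : ℝ) • x₂])
        (h1 [-((1 / 2 : ℝ) • x₂)]) (hinv _)
      rw [add_comm 1 k] at c1
      have c := (c1.mul (by omega) hw').mul (by omega) c2
      have e : ρ ((1 / 2 : ℝ) • x₁) * η ^ k • (-2 : ℝ) • a - η ^ k • (-2 : ℝ) • a *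
          ρ ((1 / 2 : ℝ) • x₁) + ε ^ (k + 1) • z +
          (η ^ k • (2 : ℝ) • b * ρ ((1 / 2 : ℝ) • x₂) -
            ρ ((1 / 2 : ℝ) • x₂) * η ^ k • (2 : ℝ) • b) = 0 := by
        rw [hηε, hab]
        simp only [map_smul, smul_mul_assoc, mul_smul_comm, smul_add, smul_sub, smul_smul]
        module
      rw [e] at c
      convert c.mem_of_zero using 2
      have s1 : wordExp ρ [x₁] = wordExp ρ [(1 / 2 : ℝ) • x₁] * wordExp ρ [(1 / 2 : ℝ) • x₁] := by
        rw [hadd]; norm_num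
      have s2 : wordExp ρ [-x₂] =
          wordExp ρ [-((1 / 2 : ℝ) • x₂)] * wordExp ρ [-((1 / 2 : ℝ) • x₂)] := by
        simp only [← neg_smul]
        rw [hadd]; norm_num
      have s3 : wordExp ρ [-((1 / 2 - ε) • x₁)] =
          wordExp ρ [-((1 / 2 : ℝ) • x₁)] * wordExp ρ [ε • x₁] := by
        rw [← neg_smul, ← neg_smul, hadd]; ring_nf
      have s4 : wordExp ρ [(1 / 2 - ε) • x₂] =
          wordExp ρ [-(ε • x₂)] * wordExp ρ [(1 / 2 : ℝ) • x₂] := by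
        rw [← neg_smul, hadd]; ring_nf
      simp only [wordExp_append, s1, s2, s3, s4, mul_assoc]

/-- If the endpoints of a corner are joined, to first order, by a segment shorter than the corner,
then they are joined by a word that is shorter than the corner. -/
theorem exists_shorter_word (p : Seminorm ℝ P) {x₁ x₂ : P}
    (hspan : Submodule.span ℝ {x₁, x₂} = ⊤) (hp : p (x₂ - x₁) < p x₁ + p x₂) :
    ∃ w : List P, wordCost p w < p x₁ + p x₂ ∧ wordExp ρ ([x₁] ++ w ++ [-x₂]) = 1 := by
  obtain ⟨w, hw, h⟩ := exists_shorter_word_mod hρ p hspan hp (k := Φ.bound + 1) (by omega)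
  refine ⟨w, hw, ?_⟩
  have h0 := Φ.anti (show Φ.bound ≤ Φ.bound + 1 + 1 by omega) h
  rwa [Φ.fil_bound, Submodule.mem_bot, sub_eq_zero] at h0

end Words

/-! ### Stratified Lie algebras and their extension by the grading derivation -/

/-- A stratification `V₁ ⊕ ⋯ ⊕ V_s` of a real Lie algebra; the layers are indexed by `ℕ`, with
`V_0 = 0` and `V_j = 0` for `j > s`. -/
structure Stratification (𝔤 : Type*) [LieRing 𝔤] [LieAlgebra ℝ 𝔤] where
  /-- the number of layers -/
  step : ℕ
  /-- the layers -/
  layer : ℕ → Submodule ℝ 𝔤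
  layer_zero : layer 0 = ⊥
  layer_of_step_lt : ∀ j, step < j → layer j = ⊥
  isInternal : DirectSum.IsInternal layer
  layer_succ : ∀ j, 1 ≤ j → layer (j + 1) =
    Submodule.span ℝ {Z | ∃ X ∈ layer 1, ∃ Y ∈ layer j, Z = ⁅X, Y⁆}

namespace Stratification

variable {𝔤 : Type*} [LieRing 𝔤] [LieAlgebra ℝ 𝔤] (S : Stratification 𝔤)

/-- The Lie algebra as the direct sum of its layers. -/
def sumEquiv : DirectSum ℕ (fun j => S.layer j) ≃ₗ[ℝ] 𝔤 :=
  LinearEquiv.ofBijective (DirectSum.coeLinearMap S.layer)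
    (show Function.Bijective (DirectSum.coeLinearMap S.layer) from S.isInternal)

/-- The linear map that multiplies the layer `j` by `f j`. -/
def gradMap (f : ℕ → ℝ) : 𝔤 →ₗ[ℝ] 𝔤 :=
  DirectSum.toModule ℝ ℕ 𝔤 (fun j => f j • (S.layer j).subtype) ∘ₗ S.sumEquiv.symm.toLinearMap

variable {S}

theorem gradMap_apply {f : ℕ → ℝ} {j : ℕ} {X : 𝔤} (hX : X ∈ S.layer j) :
    S.gradMap f X = f j • X := by
  have : S.sumEquiv.symm X = DirectSum.lof ℝ ℕ (fun j => S.layer j) j ⟨X, hX⟩ := by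
    rw [LinearEquiv.symm_apply_eq]
    exact (DirectSum.coeLinearMap_lof S.layer j ⟨X, hX⟩).symm
  simp [gradMap, this]

theorem layer_induction {p : 𝔤 → Prop} (X : 𝔤) (h : ∀ j, ∀ X ∈ S.layer j, p X)
    (hadd : ∀ X Y, p X → p Y → p (X + Y)) : p X := by
  have hX : X ∈ iSup S.layer := by
    rw [S.isInternal.submodule_iSup_eq_top]
    trivial
  exact Submodule.iSup_induction S.layer (motive := p) hX h (h 0 0 (zero_mem _)) hadd

theorem lie_mem_layer : ∀ {i j : ℕ} {X Y : 𝔤}, X ∈ S.layer i → Y ∈ S.layer j →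
    ⁅X, Y⁆ ∈ S.layer (i + j) := by
  have h0 : ∀ {X : 𝔤}, X ∈ S.layer 0 → X = 0 := fun h => by simpa [S.layer_zero] using h
  have h1 : ∀ {j : ℕ} {X Y : 𝔤}, X ∈ S.layer 1 → Y ∈ S.layer j → ⁅X, Y⁆ ∈ S.layer (j + 1) := by
    intro j X Y hX hY
    rcases Nat.eq_zero_or_pos j with rfl | hj
    · simp [h0 hY]
    · rw [S.layer_succ j hj]
      exact Submodule.subset_span ⟨X, hX, Y, hY, rfl⟩
  intro i
  induction i with
  | zero => intro j X Y hX hY; simp [h0 hX]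
  | succ i ih =>
    intro j X Y hX hY
    rcases Nat.eq_zero_or_pos i with rfl | hi
    · rw [zero_add, add_comm]
      exact h1 hX hY
    rw [S.layer_succ i hi] at hX
    induction hX using Submodule.span_induction with
    | mem Z hZ =>
      obtain ⟨A, hA, B, hB, rfl⟩ := hZ
      have e1 : ⁅A, ⁅B, Y⁆⁆ ∈ S.layer (i + 1 + j) := by
        have := h1 hA (ih hB hY)
        rwa [show i + j + 1 = i + 1 + j by ring] at this
      have e2 : ⁅B, ⁅A, Y⁆⁆ ∈ S.layer (i + 1 + j) := by
        have := ih hB (h1 hA hY)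
        rwa [show i + (j + 1) = i + 1 + j by ring] at this
      rw [lie_lie]
      exact sub_mem e1 e2
    | zero => simp
    | add Z W _ _ hZ hW => rw [add_lie]; exact add_mem hZ hW
    | smul c Z _ hZ => rw [smul_lie]; exact Submodule.smul_mem _ _ hZ

theorem ext_layer {M : Type*} [AddCommGroup M] [Module ℝ M] {f g : 𝔤 →ₗ[ℝ] M}
    (h : ∀ j, ∀ X ∈ S.layer j, f X = g X) (X : 𝔤) : f X = g X :=
  S.layer_induction (p := fun X => f X = g X) X h fun X Y hX hY => by rw [map_add, map_add, hX, hY]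

theorem gradMap_comp (f g : ℕ → ℝ) (X : 𝔤) :
    S.gradMap f (S.gradMap g X) = S.gradMap (fun j => f j * g j) X := by
  refine S.ext_layer (f := S.gradMap f ∘ₗ S.gradMap g) (fun j X hX => ?_) X
  simp [gradMap_apply hX, smul_smul, mul_comm]

theorem gradMap_one (X : 𝔤) : S.gradMap (fun _ => 1) X = X :=
  S.ext_layer (g := LinearMap.id) (fun j X hX => by simp [gradMap_apply hX]) X

variable (S) in
/-- The grading derivation, multiplication by `j` on the layer `j`. -/
def deriv : 𝔤 →ₗ[ℝ] 𝔤 := S.gradMap fun j => j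

theorem deriv_apply {j : ℕ} {X : 𝔤} (hX : X ∈ S.layer j) : S.deriv X = (j : ℝ) • X :=
  gradMap_apply hX

theorem deriv_lie (X Y : 𝔤) : S.deriv ⁅X, Y⁆ = ⁅S.deriv X, Y⁆ + ⁅X, S.deriv Y⁆ := by
  refine S.layer_induction (p := fun X => S.deriv ⁅X, Y⁆ = ⁅S.deriv X, Y⁆ + ⁅X, S.deriv Y⁆) X
    (fun i X hX => ?_) fun X X' h h' => by simp only [add_lie, map_add, h, h']; abel
  refine S.layer_induction (p := fun Y => S.deriv ⁅X, Y⁆ = ⁅S.deriv X, Y⁆ + ⁅X, S.deriv Y⁆) Y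
    (fun j Y hY => ?_) fun X X' h h' => by simp only [lie_add, map_add, h, h']; abel
  rw [deriv_apply hX, deriv_apply hY, deriv_apply (lie_mem_layer hX hY), smul_lie, lie_smul,
    ← add_smul]
  push_cast
  rfl

variable (S) in
/-- The dilation, multiplication by `r ^ j` on the layer `j`. -/
def dilation (r : ℝ) : 𝔤 →ₗ[ℝ] 𝔤 := S.gradMap fun j => r ^ j

theorem dilation_apply {r : ℝ} {j : ℕ} {X : 𝔤} (hX : X ∈ S.layer j) :
    S.dilation r X = r ^ j • X :=
  gradMap_apply hX

theorem dilation_lie (r : ℝ) (X Y : 𝔤) :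
    S.dilation r ⁅X, Y⁆ = ⁅S.dilation r X, S.dilation r Y⁆ := by
  refine S.layer_induction
    (p := fun X => S.dilation r ⁅X, Y⁆ = ⁅S.dilation r X, S.dilation r Y⁆) X
    (fun i X hX => ?_) fun X X' h h' => by simp only [add_lie, map_add, h, h']
  refine S.layer_induction
    (p := fun Y => S.dilation r ⁅X, Y⁆ = ⁅S.dilation r X, S.dilation r Y⁆) Y
    (fun j Y hY => ?_) fun X X' h h' => by simp only [lie_add, map_add, h, h']
  rw [dilation_apply hX, dilation_apply hY, dilation_apply (lie_mem_layer hX hY), smul_lie,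
    lie_smul, smul_smul, pow_add]

theorem dilation_inv {r : ℝ} (hr : r ≠ 0) (X : 𝔤) : S.dilation r (S.dilation r⁻¹ X) = X := by
  rw [dilation, dilation, gradMap_comp]
  simp only [inv_pow]
  have : (fun j => r ^ j * (r ^ j)⁻¹) = fun _ : ℕ => (1 : ℝ) :=
    funext fun j => mul_inv_cancel₀ (pow_ne_zero j hr)
  rw [this, gradMap_one]

theorem dilation_inv' {r : ℝ} (hr : r ≠ 0) (X : 𝔤) : S.dilation r⁻¹ (S.dilation r X) = X := by
  simpa using dilation_inv (S := S) (inv_ne_zero hr) X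

theorem dilation_deriv (r : ℝ) (X : 𝔤) : S.dilation r (S.deriv X) = S.deriv (S.dilation r X) := by
  rw [dilation, deriv, gradMap_comp, gradMap_comp]
  simp only [mul_comm]

variable (S) in
/-- The sum of the layers of degree at least `j`. -/
def lieFil (j : ℕ) : Submodule ℝ 𝔤 := ⨆ i, ⨆ (_ : j ≤ i), S.layer i

theorem layer_le_lieFil {i j : ℕ} (h : j ≤ i) : S.layer i ≤ S.lieFil j := le_iSup₂_of_le i h le_rfl

theorem lieFil_anti : Antitone S.lieFil := fun _ _ h =>
  iSup₂_le fun _ hi => layer_le_lieFil (h.trans hi)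

theorem lieFil_one : S.lieFil 1 = ⊤ := by
  rw [eq_top_iff, ← S.isInternal.submodule_iSup_eq_top]
  refine iSup_le fun i => ?_
  rcases Nat.eq_zero_or_pos i with rfl | hi
  · rw [S.layer_zero]; exact bot_le
  · exact layer_le_lieFil hi

theorem lieFil_step : S.lieFil (S.step + 1) = ⊥ :=
  eq_bot_iff.2 <| iSup₂_le fun i hi => by rw [S.layer_of_step_lt i hi]

theorem lieFil_induction {j : ℕ} {p : 𝔤 → Prop} {X : 𝔤} (hX : X ∈ S.lieFil j)
    (h : ∀ i, j ≤ i → ∀ X ∈ S.layer i, p X) (hadd : ∀ X Y, p X → p Y → p (X + Y)) : p X := by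
  refine Submodule.iSup_induction _ (motive := p) hX (fun i X hX => ?_)
    (h j le_rfl 0 (zero_mem _)) hadd
  by_cases hi : j ≤ i
  · exact h i hi X (by simpa [hi] using hX)
  · have : X = 0 := by simpa [hi] using hX
    exact this ▸ h j le_rfl 0 (zero_mem _)

theorem lie_mem_lieFil {i j : ℕ} {X Y : 𝔤} (hX : X ∈ S.layer i) (hY : Y ∈ S.lieFil j) :
    ⁅X, Y⁆ ∈ S.lieFil (j + i) := by
  refine lieFil_induction (p := fun Y => ⁅X, Y⁆ ∈ S.lieFil (j + i)) hY (fun k hk Y hY => ?_)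
    fun Y Y' h h' => by rw [lie_add]; exact add_mem h h'
  exact layer_le_lieFil (by omega) (lie_mem_layer hX hY)

theorem gradMap_mem_lieFil {f : ℕ → ℝ} {j : ℕ} {X : 𝔤} (hX : X ∈ S.lieFil j) :
    S.gradMap f X ∈ S.lieFil j := by
  refine lieFil_induction (p := fun X => S.gradMap f X ∈ S.lieFil j) hX (fun k hk X hX => ?_)
    fun Y Y' h h' => by rw [map_add]; exact add_mem h h'
  rw [gradMap_apply hX]
  exact Submodule.smul_mem _ _ (layer_le_lieFil hk hX)

theorem deriv_sub_mem_lieFil {j : ℕ} {X : 𝔤} (hX : X ∈ S.lieFil j) :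
    S.deriv X - (j : ℝ) • X ∈ S.lieFil (j + 1) := by
  refine lieFil_induction (p := fun X => S.deriv X - (j : ℝ) • X ∈ S.lieFil (j + 1)) hX
    (fun k hk X hX => ?_) fun Y Y' h h' => by
      convert add_mem h h' using 1
      rw [map_add, smul_add]
      abel
  rw [deriv_apply hX, ← sub_smul]
  rcases hk.eq_or_lt with rfl | hk
  · simp
  · exact Submodule.smul_mem _ _ (layer_le_lieFil hk hX)

/-! The extension `𝔤 ⊕ ℝδ`, with `[δ, X] = deriv X`, is graded with `δ` in degree `0`. The adjoint
action of `𝔤` on it is faithful, unlike the adjoint action of `𝔤` on itself. -/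

variable (S) in
/-- The adjoint action of `𝔤` on its extension `𝔤 ⊕ ℝδ` by the grading derivation `δ`. -/
def extAd : 𝔤 →ₗ[ℝ] Module.End ℝ (𝔤 × ℝ) where
  toFun Y :=
    { toFun x := (⁅Y, x.1⁆ - x.2 • S.deriv Y, 0)
      map_add' x y := by ext <;> simp [add_smul]; abel
      map_smul' c x := by ext <;> simp [smul_sub, smul_smul] }
  map_add' Y Z := by ext <;> simp; abel
  map_smul' c Y := by ext <;> simp

@[simp]
theorem extAd_apply (Y : 𝔤) (x : 𝔤 × ℝ) :
    S.extAd Y x = (⁅Y, x.1⁆ - x.2 • S.deriv Y, 0) := rfl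

theorem extAd_lie (Y Z : 𝔤) :
    S.extAd ⁅Y, Z⁆ = S.extAd Y * S.extAd Z - S.extAd Z * S.extAd Y := by
  refine LinearMap.ext fun x => ?_
  ext
  · simp only [extAd_apply, Module.End.mul_apply, LinearMap.sub_apply, Prod.fst_sub, deriv_lie,
      lie_sub, lie_smul, lie_lie, zero_smul, sub_zero, smul_add]
    rw [← lie_skew (S.deriv Y) Z]
    simp only [smul_neg]
    abel
  · simp

variable (S) in
/-- The degree filtration of `𝔤 ⊕ ℝδ`. -/
def extFil (j : ℕ) : Submodule ℝ (𝔤 × ℝ) := (S.lieFil j).prod (if j = 0 then ⊤ else ⊥)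

theorem mem_extFil {j : ℕ} {x : 𝔤 × ℝ} :
    x ∈ S.extFil j ↔ x.1 ∈ S.lieFil j ∧ (j ≠ 0 → x.2 = 0) := by
  by_cases h : j = 0 <;> simp [extFil, h]

variable (S) in
/-- The dilation of `𝔤 ⊕ ℝδ` that fixes `δ`. -/
def extDilation (r : ℝ) : (𝔤 × ℝ) →ₗ[ℝ] (𝔤 × ℝ) := (S.dilation r).prodMap LinearMap.id

variable (S) in
/-- The dilation of `𝔤 ⊕ ℝδ` as an equivalence, for `r ≠ 0`. -/
def extDilationEquiv (r : ℝ) (hr : r ≠ 0) : (𝔤 × ℝ) ≃ₗ[ℝ] (𝔤 × ℝ) :=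
  LinearEquiv.ofLinearMap (S.extDilation r) (S.extDilation r⁻¹)
    (by ext x <;> simp [extDilation, dilation_inv hr])
    (by ext x <;> simp [extDilation, dilation_inv' hr])

open scoped Classical in
variable (S) in
/-- The endomorphisms of `𝔤 ⊕ ℝδ`, with the filtration by the degree, the action of `δ` as grading
element, and conjugation by the dilations. -/
def endFiltration : DilationFiltration (Module.End ℝ (𝔤 × ℝ)) where
  fil k :=
    { carrier := {T | ∀ j, ∀ x ∈ S.extFil j, T x ∈ S.extFil (j + k)}
      zero_mem' := fun j x _ => zero_mem _
      add_mem' := fun hT hU j x hx => add_mem (hT j x hx) (hU j x hx)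
      smul_mem' := fun c T hT j x hx => Submodule.smul_mem _ c (hT j x hx) }
  bound := S.step + 1
  anti := fun k l h T hT j x hx => by
    have := mem_extFil.1 (hT j x hx)
    refine mem_extFil.2 ⟨lieFil_anti (by omega) this.1, fun h0 => this.2 (by omega)⟩
  one_mem := fun j x hx => hx
  mul_mem := fun {k l T U} hT hU j x hx => by
    have := hT _ _ (hU j x hx)
    rwa [show j + l + k = j + (k + l) by ring] at this
  fil_bound := by
    refine eq_bot_iff.2 fun T hT => LinearMap.ext fun x => ?_
    have := mem_extFil.1 (hT 0 x (mem_extFil.2 ⟨?_, by simp⟩))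
    · rw [zero_add, lieFil_step] at this
      exact Prod.ext (by simpa using this.1) (this.2 (by omega))
    · exact lieFil_anti zero_le_one (by rw [lieFil_one]; trivial)
  D := S.deriv.prodMap 0
  comm_D := fun {k T} hT j x hx => by
    have hv : ∀ m, ∀ x ∈ S.extFil m,
        (S.deriv.prodMap (0 : ℝ →ₗ[ℝ] ℝ)) x - (m : ℝ) • x ∈ S.extFil (m + 1) := by
      intro m x hx
      have hx := mem_extFil.1 hx
      refine mem_extFil.2 ⟨deriv_sub_mem_lieFil hx.1, fun _ => ?_⟩
      rcases Nat.eq_zero_or_pos m with rfl | hm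
      · simp
      · simp [hx.2 (by omega)]
    have h1 := hv _ _ (hT j x hx)
    have h2 := hT _ _ (hv j x hx)
    rw [show j + 1 + k = j + k + 1 by ring] at h2
    rw [← add_assoc]
    convert sub_mem h1 h2 using 1
    simp only [LinearMap.sub_apply, Module.End.mul_apply, LinearMap.smul_apply, map_sub, map_smul]
    push_cast
    rw [add_smul]
    abel
  dil r := if hr : r = 0 then AlgHom.id ℝ _ else (S.extDilationEquiv r hr).conjAlgEquiv ℝ
  dil_mem := fun {k T r} hT j x hx => by
    have hv : ∀ r m, ∀ x ∈ S.extFil m, S.extDilation r x ∈ S.extFil m := by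
      intro r m x hx
      have hx := mem_extFil.1 hx
      exact mem_extFil.2 ⟨gradMap_mem_lieFil hx.1, hx.2⟩
    by_cases hr : r = 0
    · simpa [hr] using hT j x hx
    · simp only [hr, dite_false]
      exact hv r _ _ (hT _ _ (hv r⁻¹ _ _ hx))

theorem endFiltration_dil {r : ℝ} (hr : r ≠ 0) (T : Module.End ℝ (𝔤 × ℝ)) (x : 𝔤 × ℝ) :
    S.endFiltration.dil r T x = S.extDilation r (T (S.extDilation r⁻¹ x)) := by
  simp only [endFiltration, hr, dite_false]
  rfl

/-- The action of the layer `j` is homogeneous of degree `j`. -/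
theorem extAd_mem_homog {j : ℕ} {Y : 𝔤} (hY : Y ∈ S.layer j) :
    S.extAd Y ∈ S.endFiltration.homog j := by
  refine ⟨fun m x hx => ?_, ?_, fun r hr => ?_⟩
  · have hx := mem_extFil.1 hx
    refine mem_extFil.2 ⟨sub_mem (lie_mem_lieFil hY hx.1) ?_, fun _ => rfl⟩
    rcases Nat.eq_zero_or_pos m with rfl | hm
    · refine Submodule.smul_mem _ _ ?_
      rw [deriv_apply hY]
      exact Submodule.smul_mem _ _ (layer_le_lieFil (by omega) hY)
    · rw [hx.2 (by omega), zero_smul]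
      exact zero_mem _
  · refine LinearMap.ext fun x => Prod.ext ?_ ?_
    · simp [endFiltration, deriv_lie, deriv_apply hY, smul_sub]
      rw [smul_comm x.2 (j : ℝ)]
      abel
    · simp [endFiltration]
  · refine LinearMap.ext fun x => ?_
    rw [endFiltration_dil hr]
    refine Prod.ext ?_ ?_
    · simp [extDilation, dilation_lie, dilation_inv hr, dilation_deriv, dilation_apply hY, smul_sub]
      rw [smul_comm]
    · simp [extDilation]

variable (S) in
/-- The action of the first layer on `𝔤 ⊕ ℝδ`. -/
def firstAd : S.layer 1 →ₗ[ℝ] Module.End ℝ (𝔤 × ℝ) := S.extAd ∘ₗ (S.layer 1).subtype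

theorem range_firstAd_le : LinearMap.range S.firstAd ≤ S.endFiltration.homog 1 := by
  rintro _ ⟨X, rfl⟩
  exact extAd_mem_homog X.2

/-- The action of the layer `j` consists of iterated commutators of the action of the first layer. -/
theorem extAd_mem_lieLayer : ∀ {j : ℕ} {Y : 𝔤}, Y ∈ S.layer j →
    S.extAd Y ∈ lieLayer (LinearMap.range S.firstAd) j
  | 0, Y, hY => by
    have : Y = 0 := by simpa [S.layer_zero] using hY
    simp [this]
  | 1, Y, hY => ⟨⟨Y, hY⟩, rfl⟩
  | j + 2, Y, hY => by
    rw [S.layer_succ (j + 1) (by omega)] at hY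
    induction hY using Submodule.span_induction with
    | mem Z hZ =>
      obtain ⟨A, hA, B, hB, rfl⟩ := hZ
      rw [extAd_lie]
      exact Submodule.subset_span ⟨_, ⟨⟨A, hA⟩, rfl⟩, _, extAd_mem_lieLayer hB, rfl⟩
    | zero => simp
    | add Z W _ _ hZ hW => rw [map_add]; exact add_mem hZ hW
    | smul c Z _ hZ => rw [map_smul]; exact Submodule.smul_mem _ _ hZ

end Stratification

/-! ### Left velocities of curves in a Lie group and the adjoint representation -/

section LieGroupCalculus

variable {E : Type*} [NormedAddCommGroup E] [NormedSpace ℝ E]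
  {G : Type*} [TopologicalSpace G] [ChartedSpace E G]

variable (E) in
/-- The derivative of a self-map of `G`, read as an endomorphism of `E` through the definition
of the tangent spaces. -/
abbrev tangentMapE (f : G → G) (x : G) : E →L[ℝ] E := mfderiv 𝓘(ℝ, E) 𝓘(ℝ, E) f x

theorem tangentMapE_comp {f g : G → G} {x y : G} (hg : MDifferentiableAt 𝓘(ℝ, E) 𝓘(ℝ, E) g y)
    (hf : MDifferentiableAt 𝓘(ℝ, E) 𝓘(ℝ, E) f x) (h : f x = y) :
    tangentMapE E (g ∘ f) x = (tangentMapE E g y).comp (tangentMapE E f x) := by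
  subst h
  exact mfderiv_comp (I' := 𝓘(ℝ, E)) x hg hf

theorem tangentMapE_id (x : G) : tangentMapE E (fun y : G => y) x = ContinuousLinearMap.id ℝ E :=
  mfderiv_id

variable [Group G]

variable (E) in
/-- The derivative at the identity of the left translation by `g`. -/
def dL (g : G) : E →L[ℝ] E := tangentMapE E (fun x => g * x) 1

variable (E) in
/-- The derivative at the identity of the right translation by `g`. -/
def dR (g : G) : E →L[ℝ] E := tangentMapE E (fun x => x * g) 1

variable (E) in
/-- The adjoint representation: the derivative at the identity of the conjugation by `g`. -/
def Ad (g : G) : E →L[ℝ] E := tangentMapE E (fun x => g * x * g⁻¹) 1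

/-- The curve `c` is differentiable at `t`, with derivative the left translate of `v`. The velocity
`v` is taken in the model space `E` of the Lie algebra. -/
def HasVel (c : ℝ → G) (v : E) (t : ℝ) : Prop :=
  HasMFDerivAt 𝓘(ℝ, ℝ) 𝓘(ℝ, E) c t ((1 : ℝ →L[ℝ] ℝ).smulRight (dL E (c t) v) : ℝ →L[ℝ] E)

theorem HasVel.continuousAt {c : ℝ → G} {v : E} {t : ℝ}
    (h : HasVel c v t) : ContinuousAt c t := HasMFDerivAt.continuousAt h

theorem HasVel.congr_vel {c : ℝ → G} {v w : E} {t : ℝ} (h : HasVel c v t) (e : v = w) :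
    HasVel c w t := e ▸ h

theorem HasVel.congr {c d : ℝ → G} {v : E} {t : ℝ}
    (h : HasVel c v t) (hcd : d =ᶠ[𝓝 t] c) : HasVel d v t := by
  have := HasMFDerivAt.congr_of_eventuallyEq h hcd
  rw [HasVel, hcd.eq_of_nhds]
  exact this

theorem Ad_one : Ad E (1 : G) = ContinuousLinearMap.id ℝ E := by
  rw [Ad, ← tangentMapE_id (1 : G)]
  congr 1
  funext x
  simp

theorem HasVel.comp {c : ℝ → G} {v : E} {b : ℝ → ℝ} {b' t : ℝ}
    (hc : HasVel c v (b t)) (hb : HasDerivAt b b' t) : HasVel (fun s => c (b s)) (b' • v) t := by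
  have h := HasMFDerivAt.comp t hc hb.hasFDerivAt.hasMFDerivAt
  refine HasMFDerivAt.congr_mfderiv h (ContinuousLinearMap.ext fun (r : ℝ) => ?_)
  have goal : (r * b') • dL E (c (b t)) v = r • dL E (c (b t)) (b' • v) := by
    rw [map_smul, smul_smul]
  exact goal

theorem hasVel_const (g : G) (t : ℝ) : HasVel (fun _ => g) (0 : E) t := by
  refine HasMFDerivAt.congr_mfderiv (hasMFDerivAt_const g t) (ContinuousLinearMap.ext fun (r : ℝ) => ?_)
  have goal : (0 : E) = r • dL E g (0 : E) := by simp
  exact goal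

theorem dL_one : dL E (1 : G) = ContinuousLinearMap.id ℝ E := by
  rw [dL, ← tangentMapE_id (1 : G)]
  congr 1
  funext x
  exact one_mul x

variable [LieGroup 𝓘(ℝ, E) ∞ G]

theorem mdiff_mul_left (g x : G) : MDifferentiableAt 𝓘(ℝ, E) 𝓘(ℝ, E) (fun y : G => g * y) x :=
  (contMDiff_mul_left (I := 𝓘(ℝ, E)) (n := ∞) (a := g)).contMDiffAt.mdifferentiableAt (by simp)

theorem mdiff_mul_right (g x : G) : MDifferentiableAt 𝓘(ℝ, E) 𝓘(ℝ, E) (fun y : G => y * g) x :=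
  (contMDiff_mul_right (I := 𝓘(ℝ, E)) (n := ∞) (a := g)).contMDiffAt.mdifferentiableAt (by simp)

theorem mdiff_mul (p : G × G) : MDifferentiableAt (𝓘(ℝ, E).prod 𝓘(ℝ, E)) 𝓘(ℝ, E)
    (fun p : G × G => p.1 * p.2) p :=
  (contMDiff_mul 𝓘(ℝ, E) ∞).contMDiffAt.mdifferentiableAt (by simp)

theorem mdiff_mul_mul (g h x : G) :
    MDifferentiableAt 𝓘(ℝ, E) 𝓘(ℝ, E) (fun y : G => g * y * h) x :=
  (mdiff_mul_right h (g * x)).comp x (mdiff_mul_left g x)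

theorem dL_eq_dR_comp_Ad (g : G) : dL E g = (dR E g).comp (Ad E g) := by
  rw [dL, dR, Ad, ← tangentMapE_comp (mdiff_mul_right g 1) (mdiff_mul_mul g g⁻¹ 1) (by simp)]
  congr 1
  funext x
  simp

theorem tangentMapE_mul_left (g h : G) :
    (tangentMapE E (fun x => g * x) h).comp (dL E h) = dL E (g * h) := by
  rw [dL, dL, ← tangentMapE_comp (mdiff_mul_left g h) (mdiff_mul_left h 1) (by simp)]
  congr 1
  funext x
  simp [mul_assoc]

theorem tangentMapE_mul_right (g h : G) :
    (tangentMapE E (fun x => x * h) g).comp (dL E g) = (dL E (g * h)).comp (Ad E h⁻¹) := by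
  rw [dL, dL, Ad, ← tangentMapE_comp (mdiff_mul_right h g) (mdiff_mul_left g 1) (by simp),
    ← tangentMapE_comp (mdiff_mul_left (g * h) 1) (mdiff_mul_mul h⁻¹ h⁻¹⁻¹ 1) (by simp)]
  congr 1
  funext x
  simp [mul_assoc]

theorem Ad_mul (g h : G) : Ad E (g * h) = (Ad E g).comp (Ad E h) := by
  rw [Ad, Ad, Ad, ← tangentMapE_comp (mdiff_mul_mul g g⁻¹ 1) (mdiff_mul_mul h h⁻¹ 1) (by simp)]
  congr 1
  funext x
  simp [mul_assoc]

theorem Ad_inv_mul (g : G) : (Ad E g⁻¹).comp (Ad E g) = ContinuousLinearMap.id ℝ E := by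
  rw [← Ad_mul]; simp [Ad_one]

/-- The product rule for left velocities. -/
theorem HasVel.mul {c d : ℝ → G} {u v : E} {t : ℝ}
    (hc : HasVel c u t) (hd : HasVel d v t) :
    HasVel (fun s => c s * d s) (Ad E (d t)⁻¹ u + v) t := by
  have h := (mdiff_mul (E := E) (c t, d t)).hasMFDerivAt.comp t (HasMFDerivAt.prodMk hc hd)
  refine HasMFDerivAt.congr_mfderiv h (ContinuousLinearMap.ext fun (r : ℝ) => ?_)
  refine (mfderiv_prod_eq_add_apply (mdiff_mul (E := E) (c t, d t))).trans ?_
  have e1 := congrArg (fun T : E →L[ℝ] E => T (r • u)) (tangentMapE_mul_right (E := E) (c t) (d t))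
  have e2 := congrArg (fun T : E →L[ℝ] E => T (r • v)) (tangentMapE_mul_left (E := E) (c t) (d t))
  have f1 : dL E (c t) (r • u) = r • dL E (c t) u := map_smul _ _ _
  have f2 : dL E (d t) (r • v) = r • dL E (d t) v := map_smul _ _ _
  have goal : tangentMapE E (fun x => x * d t) (c t) (r • dL E (c t) u) +
      tangentMapE E (fun x => c t * x) (d t) (r • dL E (d t) v) =
      r • dL E (c t * d t) (Ad E (d t)⁻¹ u + v) := by
    rw [← f1, ← f2]
    refine (congrArg₂ (· + ·) e1 e2).trans ?_
    simp only [ContinuousLinearMap.comp_apply, map_smul, map_add, smul_add]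
  exact goal

theorem HasVel.const_mul (g : G) {c : ℝ → G} {v : E} {t : ℝ}
    (hc : HasVel c v t) : HasVel (fun s => g * c s) v t := by
  have h := (mdiff_mul_left (E := E) g (c t)).hasMFDerivAt.comp t hc
  refine HasMFDerivAt.congr_mfderiv h (ContinuousLinearMap.ext fun (r : ℝ) => ?_)
  have e2 := congrArg (fun T : E →L[ℝ] E => T (r • v)) (tangentMapE_mul_left (E := E) g (c t))
  have f2 : dL E (c t) (r • v) = r • dL E (c t) v := map_smul _ _ _
  have f3 : dL E (g * c t) (r • v) = r • dL E (g * c t) v := map_smul _ _ _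
  have goal : tangentMapE E (fun x => g * x) (c t) (r • dL E (c t) v) =
      r • dL E (g * c t) v := by
    rw [← f2, ← f3]
    exact e2
  exact goal

theorem dL_injective (g : G) : Function.Injective (dL E g) := by
  intro v w h
  have e := tangentMapE_mul_left (E := E) g⁻¹ g
  rw [inv_mul_cancel, dL_one] at e
  have e1 := congrArg (fun T : E →L[ℝ] E => T v) e
  have e2 := congrArg (fun T : E →L[ℝ] E => T w) e
  simp only [ContinuousLinearMap.comp_apply] at e1 e2
  rw [h] at e1
  exact e1.symm.trans e2

section Complete

variable [FiniteDimensional ℝ E] [T2Space G]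

/-- A curve with constant left velocity is determined by its value at one time. -/
theorem eq_of_hasVel {v : GroupLieAlgebra 𝓘(ℝ, E) G} {c d : ℝ → G} {t₀ : ℝ}
    (hc : ∀ t, HasVel (E := E) c v t) (hd : ∀ t, HasVel (E := E) d v t) (h : c t₀ = d t₀) : c = d := by
  have : CompleteSpace E := FiniteDimensional.complete ℝ E
  have : LieGroup 𝓘(ℝ, E) (minSmoothness ℝ 3) G :=
    LieGroup.of_le (n := ∞) (by
      rw [minSmoothness_of_isRCLikeNormedField]
      exact ENat.LEInfty.out)
  have : IsManifold 𝓘(ℝ, E) ∞ G := ContMDiffMul.toIsManifold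
  have : IsManifold 𝓘(ℝ, E) 1 G := IsManifold.of_le (n := ∞) (by simp)
  exact isMIntegralCurve_Ioo_eq_of_contMDiff_boundaryless
    ((contMDiff_mulInvariantVectorField v).of_le (by simp)) hc hd h

theorem eq_lieExp_of_hasVel {v : GroupLieAlgebra 𝓘(ℝ, E) G} {c : ℝ → G} (h0 : c 0 = 1)
    (hc : ∀ t, HasVel (E := E) c v t) (t : ℝ) : c t = lieExp (t • v) := by
  have hs := (exists_isMIntegralCurve_mulInvariantVectorField (t • v)).choose_spec
  have hd : ∀ s, HasVel (E := E) (fun s => c (s * t)) (t • (v : E)) s := fun s =>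
    HasVel.comp (b := fun s => s * t) (hc _) (by simpa using (hasDerivAt_id s).mul_const t)
  have := eq_of_hasVel (t₀ := 0) hd hs.2 (by simp [h0, hs.1])
  simpa [lieExp] using congrFun this 1

theorem lieExp_zero : lieExp (0 : GroupLieAlgebra 𝓘(ℝ, E) G) = 1 := by
  have := eq_lieExp_of_hasVel (v := (0 : GroupLieAlgebra 𝓘(ℝ, E) G)) (c := fun _ => (1 : G)) rfl
    (hasVel_const (E := E) 1) 0
  rw [zero_smul] at this
  exact this.symm

theorem hasVel_lieExp (v : GroupLieAlgebra 𝓘(ℝ, E) G) (t : ℝ) :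
    HasVel (E := E) (fun s => lieExp (s • v)) v t := by
  have hs := (exists_isMIntegralCurve_mulInvariantVectorField v).choose_spec
  have : (exists_isMIntegralCurve_mulInvariantVectorField v).choose = fun s => lieExp (s • v) :=
    funext fun s => eq_lieExp_of_hasVel hs.1 hs.2 s
  rw [← this]
  exact hs.2 t

theorem lieExp_add (v : GroupLieAlgebra 𝓘(ℝ, E) G) (s t : ℝ) :
    lieExp ((s + t) • v) = lieExp (s • v) * lieExp (t • v) := by
  have hd : ∀ r, HasVel (E := E) (fun r => lieExp (s • v) * lieExp (r • v)) v r := fun r =>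
    (hasVel_lieExp v r).const_mul _
  have hc : ∀ r, HasVel (E := E) (fun r => lieExp ((s + r) • v)) v r := fun r => by
    exact (HasVel.comp (b := fun r => s + r) (hasVel_lieExp v (s + r))
      ((hasDerivAt_id r).const_add s)).congr_vel (one_smul ℝ _)
  exact congrFun (eq_of_hasVel (t₀ := 0) hc hd (by simp [lieExp_zero])) t

theorem lieExp_neg (v : GroupLieAlgebra 𝓘(ℝ, E) G) : lieExp (-v) = (lieExp v)⁻¹ := by
  rw [eq_inv_iff_mul_eq_one]
  have := lieExp_add v (-1) 1
  simpa [lieExp_zero] using this.symm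

end Complete

end LieGroupCalculus

/-! ### The derivative of the adjoint representation -/

section ChartComputation

variable {E : Type*} [NormedAddCommGroup E] [NormedSpace ℝ E]
  {G : Type*} [TopologicalSpace G] [ChartedSpace E G] [Group G]

variable (E G) in
/-- The multiplication of `G`, read in the chart at the identity. -/
def chartMul (p : E × E) : E :=
  extChartAt 𝓘(ℝ, E) (1 : G)
    ((extChartAt 𝓘(ℝ, E) (1 : G)).symm p.1 * (extChartAt 𝓘(ℝ, E) (1 : G)).symm p.2)

variable (E) in
/-- The derivative at `g` of the chart at the identity. -/
def chartDeriv (g : G) : E →L[ℝ] E := mfderiv 𝓘(ℝ, E) 𝓘(ℝ, E) (extChartAt 𝓘(ℝ, E) (1 : G)) g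

variable [LieGroup 𝓘(ℝ, E) ∞ G]

local notation "φ" => extChartAt 𝓘(ℝ, E) (1 : G)

theorem two_le_infty : (2 : WithTop ℕ∞) ≤ ((⊤ : ℕ∞) : WithTop ℕ∞) := ENat.LEInfty.out

theorem one_le_infty : (1 : WithTop ℕ∞) ≤ ((⊤ : ℕ∞) : WithTop ℕ∞) := ENat.LEInfty.out

theorem isManifold_one : IsManifold 𝓘(ℝ, E) 1 G :=
  have : IsManifold 𝓘(ℝ, E) ∞ G := ContMDiffMul.toIsManifold
  IsManifold.of_le (n := ∞) (by simp)

theorem contDiffAt_chartMul : ContDiffAt ℝ ∞ (chartMul E G) (φ 1, φ 1) := by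
  have : IsManifold 𝓘(ℝ, E) ∞ G := ContMDiffMul.toIsManifold
  rw [← contMDiffAt_iff_contDiffAt]
  have hs : ContMDiffAt 𝓘(ℝ, E) 𝓘(ℝ, E) ∞ (φ).symm (φ 1) :=
    (contMDiffOn_extChartAt_symm (1 : G)).contMDiffAt (extChartAt_target_mem_nhds 1)
  have h1 : ContMDiffAt 𝓘(ℝ, E × E) 𝓘(ℝ, E) ∞ (fun p : E × E => (φ).symm p.1) (φ 1, φ 1) :=
    ContMDiffAt.comp (φ 1, φ 1) (g := (φ).symm) (f := Prod.fst) hs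
      contDiff_fst.contMDiff.contMDiffAt
  have h2 : ContMDiffAt 𝓘(ℝ, E × E) 𝓘(ℝ, E) ∞ (fun p : E × E => (φ).symm p.2) (φ 1, φ 1) :=
    ContMDiffAt.comp (φ 1, φ 1) (g := (φ).symm) (f := Prod.snd) hs
      contDiff_snd.contMDiff.contMDiffAt
  have h3 := h1.mul h2
  have h4 : ContMDiffAt 𝓘(ℝ, E) 𝓘(ℝ, E) ∞ (φ)
      ((φ).symm (φ (1 : G)) * (φ).symm (φ (1 : G))) := by
    rw [extChartAt_to_inv, mul_one]
    exact contMDiffAt_extChartAt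
  exact h4.comp (φ 1, φ 1) h3

theorem hasMFDerivAt_chart_symm : HasMFDerivAt 𝓘(ℝ, E) 𝓘(ℝ, E) (φ).symm (φ 1)
    (ContinuousLinearMap.id ℝ E) := by
  have := isManifold_one (E := E) (G := G)
  have hs : MDifferentiableAt 𝓘(ℝ, E) 𝓘(ℝ, E) (φ).symm (φ 1) :=
    ((contMDiffOn_extChartAt_symm (n := 1) (1 : G)).contMDiffAt
      (extChartAt_target_mem_nhds 1)).mdifferentiableAt one_ne_zero
  have h := hs.hasMFDerivAt
  have e := mfderivWithin_range_extChartAt_symm (I := 𝓘(ℝ, E)) (x := (1 : G))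
  rw [ModelWithCorners.range_eq_univ, mfderivWithin_univ] at e
  exact HasMFDerivAt.congr_mfderiv h e

/-- The derivative, in the chart, of a map defined near the identity. -/
theorem hasFDerivAt_chart {k : G → G} {g : G} (hk : MDifferentiableAt 𝓘(ℝ, E) 𝓘(ℝ, E) k 1)
    (hg : k 1 = g) (hgs : g ∈ (chartAt E (1 : G)).source) :
    HasFDerivAt (fun y : E => φ (k ((φ).symm y))) ((chartDeriv E g).comp (tangentMapE E k 1))
      (φ 1) := by
  have := isManifold_one (E := E) (G := G)
  subst hg
  have h1 := (mdifferentiableAt_extChartAt (I := 𝓘(ℝ, E)) hgs).hasMFDerivAt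
  have h2 := HasMFDerivAt.comp (1 : G) h1 hk.hasMFDerivAt
  have h3 : HasMFDerivAt 𝓘(ℝ, E) 𝓘(ℝ, E) ((φ) ∘ k) ((φ).symm (φ 1))
      ((chartDeriv E (k 1)).comp (tangentMapE E k 1)) := by
    rw [extChartAt_to_inv]
    exact h2
  have h4 := HasMFDerivAt.comp (φ 1) h3 hasMFDerivAt_chart_symm
  exact hasMFDerivAt_iff_hasFDerivAt.1 h4

theorem hasFDerivAt_chartMul_right {x : E} (hx : x ∈ (φ).target) :
    HasFDerivAt (fun y : E => chartMul E G (x, y))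
      ((chartDeriv E ((φ).symm x)).comp (dL E ((φ).symm x))) (φ 1) :=
  hasFDerivAt_chart (mdiff_mul_left _ _) (mul_one _)
    (by simpa [extChartAt_source] using (φ).map_target hx)

theorem hasFDerivAt_chartMul_left {x : E} (hx : x ∈ (φ).target) :
    HasFDerivAt (fun y : E => chartMul E G (y, x))
      ((chartDeriv E ((φ).symm x)).comp (dR E ((φ).symm x))) (φ 1) :=
  hasFDerivAt_chart (mdiff_mul_right _ _) (one_mul _)
    (by simpa [extChartAt_source] using (φ).map_target hx)

/-- The partial derivatives of the multiplication in the chart are the derivatives of the left and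
right translations. -/
theorem eventually_chart :
    ∀ᶠ x in 𝓝 (φ (1 : G)), x ∈ (φ).target ∧
      (∀ X, fderiv ℝ (chartMul E G) (x, φ 1) (0, X) =
        chartDeriv E ((φ).symm x) (dL E ((φ).symm x) X)) ∧
      (∀ X, fderiv ℝ (chartMul E G) (φ 1, x) (X, 0) =
        chartDeriv E ((φ).symm x) (dR E ((φ).symm x) X)) := by
  have hd : ∀ᶠ p in 𝓝 (φ (1 : G), φ (1 : G)), DifferentiableAt ℝ (chartMul E G) p := by
    have := ((contDiffAt_chartMul (E := E) (G := G)).of_le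
      (m := 1) one_le_infty).eventually (by simp)
    exact this.mono fun p hp => hp.differentiableAt (by simp)
  have h1 : ∀ᶠ x in 𝓝 (φ (1 : G)), DifferentiableAt ℝ (chartMul E G) (x, φ 1) :=
    (Continuous.prodMk_left (φ (1 : G))).continuousAt.eventually hd
  have h2 : ∀ᶠ x in 𝓝 (φ (1 : G)), DifferentiableAt ℝ (chartMul E G) (φ 1, x) :=
    (Continuous.prodMk_right (φ (1 : G))).continuousAt.eventually hd
  filter_upwards [extChartAt_target_mem_nhds (I := 𝓘(ℝ, E)) (1 : G), h1, h2] with x hx h1 h2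
  refine ⟨hx, fun X => ?_, fun X => ?_⟩
  · have e := HasFDerivAt.comp (g := chartMul E G) (f := fun y => (x, y)) (φ (1 : G)) h1.hasFDerivAt
      (hasFDerivAt_prodMk_right (𝕜 := ℝ) x (φ (1 : G)))
    have := e.unique (hasFDerivAt_chartMul_right hx)
    exact congrArg (fun T : E →L[ℝ] E => T X) this
  · have e := HasFDerivAt.comp (g := chartMul E G) (f := fun y => (y, x)) (φ (1 : G)) h2.hasFDerivAt
      (hasFDerivAt_prodMk_left (𝕜 := ℝ) (φ (1 : G)) x)
    have := e.unique (hasFDerivAt_chartMul_left hx)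
    exact congrArg (fun T : E →L[ℝ] E => T X) this

theorem chartDeriv_one : chartDeriv E (1 : G) = ContinuousLinearMap.id ℝ E :=
  have := isManifold_one (E := E) (G := G)
  mfderiv_extChartAt_self

variable (E G) in
/-- The left-invariant vector field equal to `X` at the identity, read in the chart. -/
def chartField (X : E) : E → E :=
  VectorField.mpullbackWithin 𝓘(ℝ, E) 𝓘(ℝ, E) (φ).symm
    (mulInvariantVectorField (X : GroupLieAlgebra 𝓘(ℝ, E) G)) (range 𝓘(ℝ, E))

theorem chartField_eventuallyEq (X : E) :
    chartField E G X =ᶠ[𝓝 (φ (1 : G))] fun x => fderiv ℝ (chartMul E G) (x, φ 1) (0, X) := by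
  have := isManifold_one (E := E) (G := G)
  filter_upwards [eventually_chart (E := E) (G := G)] with x hx
  refine Eq.trans ?_ (hx.2.1 X).symm
  rw [chartField, VectorField.mpullbackWithin_apply,
    ContinuousLinearMap.inverse_eq (mfderivWithin_extChartAt_symm_comp_mfderiv_extChartAt hx.1)
    (mfderiv_extChartAt_comp_mfderivWithin_extChartAt_symm hx.1)]
  rfl

theorem hasFDerivAt_fderiv_chartMul : HasFDerivAt (fderiv ℝ (chartMul E G))
    (fderiv ℝ (fderiv ℝ (chartMul E G)) (φ 1, φ 1)) (φ 1, φ 1) :=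
  (((contDiffAt_chartMul (E := E) (G := G)).fderiv_right (m := 1) (by
    rw [one_add_one_eq_two]; exact two_le_infty)).differentiableAt (by simp)).hasFDerivAt

theorem hasFDerivAt_fderiv_chartMul_left (X : E) :
    HasFDerivAt (fun x => fderiv ℝ (chartMul E G) (x, φ 1) (0, X))
      ((fderiv ℝ (fderiv ℝ (chartMul E G)) (φ 1, φ 1)).flip ((0 : E), X) ∘L
        ContinuousLinearMap.inl ℝ E E) (φ 1) := by
  have h1 := HasFDerivAt.comp (g := fderiv ℝ (chartMul E G)) (f := fun x => (x, φ (1 : G)))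
    (φ (1 : G)) hasFDerivAt_fderiv_chartMul
    (hasFDerivAt_prodMk_left (𝕜 := ℝ) (φ (1 : G)) (φ (1 : G)))
  have h2 := h1.clm_apply (hasFDerivAt_const ((0 : E), X) (φ (1 : G)))
  refine h2.congr_fderiv (ContinuousLinearMap.ext fun v => ?_)
  simp

theorem fderiv_chartMul_apply (X : E) :
    fderiv ℝ (chartMul E G) (φ 1, φ 1) (0, X) = X ∧
    fderiv ℝ (chartMul E G) (φ 1, φ 1) (X, 0) = X := by
  have h := (eventually_chart (E := E) (G := G)).self_of_nhds
  have h1 : dR E (1 : G) = ContinuousLinearMap.id ℝ E := by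
    have := dL_eq_dR_comp_Ad (E := E) (1 : G)
    rw [Ad_one, dL_one, ContinuousLinearMap.comp_id] at this
    exact this.symm
  rw [h.2.1, h.2.2, extChartAt_to_inv, chartDeriv_one, dL_one, h1]
  exact ⟨rfl, rfl⟩

variable (E G) in
/-- The bracket of the Lie algebra of `G`, as an operation on `E`. -/
def bracketE (Y X : E) : E :=
  Bracket.bracket (L := GroupLieAlgebra 𝓘(ℝ, E) G) (M := GroupLieAlgebra 𝓘(ℝ, E) G) Y X

/-- The bracket of the Lie algebra, in terms of the second derivative of the multiplication. -/
theorem bracketE_eq (X Y : E) :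
    bracketE E G Y X =
      fderiv ℝ (fderiv ℝ (chartMul E G)) (φ (1 : G), φ (1 : G)) (Y, 0) (0, X) -
      fderiv ℝ (fderiv ℝ (chartMul E G)) (φ (1 : G), φ (1 : G)) (X, 0) (0, Y) := by
  have := isManifold_one (E := E) (G := G)
  have hinv : (mfderiv 𝓘(ℝ, E) 𝓘(ℝ, E) (φ) (1 : G)).inverse =
      ContinuousLinearMap.id ℝ E := by
    rw [mfderiv_extChartAt_self]
    exact ContinuousLinearMap.inverse_id
  have hset : (φ).symm ⁻¹' (univ : Set G) ∩ range 𝓘(ℝ, E) = univ := by simp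
  have e1 : bracketE E G Y X = (mfderiv 𝓘(ℝ, E) 𝓘(ℝ, E) (φ) (1 : G)).inverse
      (VectorField.lieBracketWithin ℝ (chartField E G Y) (chartField E G X)
        ((φ).symm ⁻¹' (univ : Set G) ∩ range 𝓘(ℝ, E)) (φ (1 : G)) : E) :=
    VectorField.mlieBracketWithin_apply
  rw [hset] at e1
  refine (e1.trans (congrArg (fun T : E →L[ℝ] E => T _) hinv)).trans ?_
  refine (congrFun VectorField.lieBracketWithin_univ _).trans ?_
  have h := Filter.EventuallyEq.lieBracket_vectorField_eq (𝕜 := ℝ)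
    (chartField_eventuallyEq (G := G) Y) (chartField_eventuallyEq (G := G) X)
  refine Eq.trans h ?_
  rw [VectorField.lieBracket, (hasFDerivAt_fderiv_chartMul_left (G := G) X).fderiv,
    (hasFDerivAt_fderiv_chartMul_left (G := G) Y).fderiv, (fderiv_chartMul_apply _).1,
    (fderiv_chartMul_apply _).1]
  rfl

/-- The derivative of the adjoint representation at the identity is the bracket. In the chart, the
relation between left and right translations reads `∂₁m(1, c) Ad(c) X = ∂₂m(c, 1) X`, for the
multiplication `m`; the derivative of this relation involves only second derivatives of `m`, which
are symmetric. -/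
theorem hasDerivAt_Ad_zero [CompleteSpace E] {c : ℝ → G} {Y : E}
    (h0 : c 0 = 1) (hc : HasVel (E := E) c Y 0) X :
    HasDerivAt (fun t => Ad E (c t) X) (bracketE E G Y X) 0 := by
  have := isManifold_one (E := E) (G := G)
  rw [bracketE_eq]
  set B := fderiv ℝ (fderiv ℝ (chartMul E G)) (φ 1, φ 1) with hB
  -- the curve in the chart
  have hx : HasDerivAt (fun t => φ (c t)) Y 0 := by
    have h1 : HasMFDerivAt 𝓘(ℝ, E) 𝓘(ℝ, E) (φ) (c 0) (chartDeriv E (c 0)) := by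
      rw [h0]
      exact (mdifferentiableAt_extChartAt (mem_chart_source E (1 : G))).hasMFDerivAt
    have h2 := HasMFDerivAt.comp (0 : ℝ) h1 hc
    have h3 : HasFDerivAt (fun t => φ (c t))
        ((chartDeriv E (c 0)).comp ((1 : ℝ →L[ℝ] ℝ).smulRight (dL E (c 0) Y))) 0 :=
      hasMFDerivAt_iff_hasFDerivAt.1 h2
    refine h3.hasDerivAt.congr_deriv ?_
    have e : chartDeriv E (c 0) ((1 : ℝ) • dL E (c 0) Y) = Y := by
      rw [h0, chartDeriv_one, dL_one, one_smul]
      rfl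
    exact e
  have hx0 : φ (c 0) = φ (1 : G) := by rw [h0]
  -- the two sides of the relation between left and right translations
  have hP : HasDerivAt (fun t => fderiv ℝ (chartMul E G) (φ (c t), φ 1) ((0 : E), X))
      (B (Y, (0 : E)) ((0 : E), X)) 0 := by
    have h : HasFDerivAt (fun x => fderiv ℝ (chartMul E G) (x, φ 1) (0, X))
        (B.flip ((0 : E), X) ∘L ContinuousLinearMap.inl ℝ E E) (φ (c 0)) := by
      rw [hx0]
      exact hasFDerivAt_fderiv_chartMul_left X
    exact h.comp_hasDerivAt (0 : ℝ) hx
  have hM : HasDerivAt (fun t => fderiv ℝ (chartMul E G) (φ 1, φ (c t)) ∘L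
      ContinuousLinearMap.inl ℝ E E) (B ((0 : E), Y) ∘L ContinuousLinearMap.inl ℝ E E) 0 := by
    have h1 : HasFDerivAt (fderiv ℝ (chartMul E G)) B (φ (1 : G), φ (c 0)) := by
      rw [hx0]
      exact hasFDerivAt_fderiv_chartMul
    have h2 := HasFDerivAt.comp_hasDerivAt (l := fderiv ℝ (chartMul E G)) (0 : ℝ) h1
      ((hasDerivAt_const (0 : ℝ) (φ (1 : G))).prodMk hx)
    exact h2.clm_comp (hasDerivAt_const (0 : ℝ) (ContinuousLinearMap.inl ℝ E E)) |>.congr_deriv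
      (by simp)
  set M : ℝ → E →L[ℝ] E := fun t => fderiv ℝ (chartMul E G) (φ 1, φ (c t)) ∘L
      ContinuousLinearMap.inl ℝ E E with hMdef
  have hM0 : M 0 = 1 := by
    ext v
    simp only [hMdef, hx0]
    exact (fderiv_chartMul_apply v).2
  have hcont : Filter.Tendsto (fun t => φ (c t)) (𝓝 0) (𝓝 (φ (1 : G))) := by
    rw [← hx0]
    exact hx.continuousAt
  have hsrc : ∀ᶠ t in 𝓝 (0 : ℝ), c t ∈ (φ).source := by
    have : (φ).source ∈ 𝓝 (c 0) := by
      rw [h0]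
      exact extChartAt_source_mem_nhds 1
    exact hc.continuousAt.eventually this
  have hrel : ∀ᶠ t in 𝓝 (0 : ℝ), M t (Ad E (c t) X) =
      fderiv ℝ (chartMul E G) (φ (c t), φ 1) ((0 : E), X) := by
    filter_upwards [hcont.eventually (eventually_chart (E := E) (G := G)), hsrc] with t ht hs
    rw [ht.2.1, dL_eq_dR_comp_Ad]
    refine Eq.trans (ht.2.2 _) ?_
    rw [(φ).left_inv hs]
    rfl
  have hunit : ∀ᶠ t in 𝓝 (0 : ℝ), IsUnit (M t) := by
    have : {T : E →L[ℝ] E | IsUnit T} ∈ 𝓝 (M 0) :=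
      Units.isOpen.mem_nhds (by rw [mem_ofPred, hM0]; exact isUnit_one)
    exact hM.continuousAt.eventually this
  have hinv : HasDerivAt (fun t => Ring.inverse (M t))
      (-(B ((0 : E), Y) ∘L ContinuousLinearMap.inl ℝ E E)) 0 := by
    have h := hasFDerivAt_ringInverse (𝕜 := ℝ) (1 : (E →L[ℝ] E)ˣ)
    rw [Units.val_one, ← hM0] at h
    refine (h.comp_hasDerivAt (0 : ℝ) hM).congr_deriv ?_
    simp
  have hA := (hinv.clm_apply hP).congr_of_eventuallyEq (f₁ := fun t => Ad E (c t) X) (by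
    filter_upwards [hrel, hunit] with t ht hu
    rw [← ht]
    exact (congrArg (fun T : E →L[ℝ] E => T (Ad E (c t) X))
      (Ring.inverse_mul_cancel _ hu)).symm)
  refine hA.congr_deriv ?_
  have hsymm : IsSymmSndFDerivAt ℝ (chartMul E G) (φ (1 : G), φ (1 : G)) :=
    contDiffAt_chartMul.isSymmSndFDerivAt (by
      rw [minSmoothness_of_isRCLikeNormedField]; exact two_le_infty)
  have e1 : fderiv ℝ (chartMul E G) (φ (c 0), φ 1) ((0 : E), X) = X := by
    rw [hx0]
    exact (fderiv_chartMul_apply _).1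
  have e2 : B ((0 : E), Y) (X, 0) = B (X, 0) (0, Y) := hsymm.eq _ _
  rw [e1, hM0, Ring.inverse_one, ← e2]
  simp only [neg_apply, ContinuousLinearMap.comp_apply,
    ContinuousLinearMap.inl_apply, one_apply_eq_self]
  abel

end ChartComputation

/-! ### From products of exponentials in the algebra to products in the group -/

section Transfer

variable {E : Type*} [NormedAddCommGroup E] [NormedSpace ℝ E] [FiniteDimensional ℝ E]
  {G : Type*} [TopologicalSpace G] [ChartedSpace E G] [Group G] [LieGroup 𝓘(ℝ, E) ∞ G]
  [T2Space G]

/-- The derivative of the adjoint representation along a one-parameter group. -/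
theorem hasDerivAt_Ad_lieExp [CompleteSpace E] (Y X : E) (t : ℝ) :
    HasDerivAt (fun s : ℝ => Ad E (lieExp (E := E) (G := G) (s • Y)) X)
      (Ad E (lieExp (E := E) (G := G) (t • Y)) (bracketE E G Y X)) t := by
  have h0 : HasDerivAt (fun s : ℝ => Ad E (lieExp (E := E) (G := G) (s • Y)) X)
      (bracketE E G Y X) 0 := by
    refine hasDerivAt_Ad_zero (c := fun s : ℝ => lieExp (E := E) (G := G) (s • Y)) ?_
      (hasVel_lieExp (E := E) (G := G) Y 0) X
    rw [zero_smul]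
    exact lieExp_zero
  have h1 : HasDerivAt (fun s : ℝ => Ad E (lieExp (E := E) (G := G) ((s - t) • Y)) X)
      (bracketE E G Y X) t := by
    have := HasDerivAt.comp_sub_const (f := fun s : ℝ => Ad E (lieExp (E := E) (G := G) (s • Y)) X)
      (x := t) (a := t) (f' := bracketE E G Y X) (by rwa [sub_self])
    exact this
  have h2 := (Ad E (lieExp (E := E) (G := G) (t • Y))).hasFDerivAt.comp_hasDerivAt t h1
  have e : (fun s : ℝ => Ad E (lieExp (E := E) (G := G) (s • Y)) X) = fun s =>
      Ad E (lieExp (E := E) (G := G) (t • Y)) (Ad E (lieExp (E := E) (G := G) ((s - t) • Y)) X) := by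
    funext s
    have := lieExp_add (E := E) (G := G) Y t (s - t)
    rw [add_sub_cancel] at this
    rw [← ContinuousLinearMap.comp_apply, ← Ad_mul]
    exact congrArg (fun g => Ad E g X) this
  rw [e]
  exact h2

/-- On the vectors that a power of `ad Y` annihilates, `Ad (exp (t Y))` is the exponential of
`t • ad Y`. -/
theorem Ad_lieExp_eq_sum [CompleteSpace E] (Y : E) (N : ℕ) : ∀ X : E,
    (bracketE E G Y)^[N] X = 0 → ∀ t : ℝ, Ad E (lieExp (E := E) (G := G) (t • Y)) X =
      ∑ i ∈ Finset.range N, (t ^ i / i.factorial) • (bracketE E G Y)^[i] X := by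
  induction N with
  | zero =>
    intro X hX t
    have : X = 0 := hX
    simp [this]
  | succ N ih =>
    intro X hX t
    have hX' : (bracketE E G Y)^[N] (bracketE E G Y X) = 0 := hX
    have hd : ∀ t, HasDerivAt (fun t : ℝ => Ad E (lieExp (E := E) (G := G) (t • Y)) X -
        ∑ i ∈ Finset.range (N + 1), (t ^ i / i.factorial) • (bracketE E G Y)^[i] X) 0 t := by
      intro t
      have h1 := hasDerivAt_Ad_lieExp (G := G) Y X t
      rw [ih _ hX' t] at h1
      have h2 : HasDerivAt (fun t : ℝ =>
          ∑ i ∈ Finset.range (N + 1), (t ^ i / i.factorial) • (bracketE E G Y)^[i] X)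
          (∑ i ∈ Finset.range N, (t ^ i / i.factorial) • (bracketE E G Y)^[i]
            (bracketE E G Y X)) t := by
        simp only [Finset.sum_range_succ' _ N]
        have h3 : ∀ i ∈ Finset.range N, HasDerivAt (fun t : ℝ =>
            (t ^ (i + 1) / (i + 1).factorial) • (bracketE E G Y)^[i + 1] X)
            ((t ^ i / i.factorial) • (bracketE E G Y)^[i] (bracketE E G Y X)) t := by
          intro i _
          have := (((hasDerivAt_id t).pow (i + 1)).div_const ((i + 1).factorial : ℝ)).smul_const
            ((bracketE E G Y)^[i + 1] X)
          refine this.congr_deriv ?_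
          rw [Function.iterate_succ_apply, Nat.factorial_succ]
          congr 1
          have : (i.factorial : ℝ) ≠ 0 := Nat.cast_ne_zero.2 i.factorial_ne_zero
          simp only [id, Nat.cast_mul, Nat.cast_add, Nat.cast_one, Nat.add_sub_cancel, mul_one]
          field_simp
        have h4 := HasDerivAt.fun_sum h3
        simpa using h4.add_const ((bracketE E G Y)^[0] X)
      exact (h1.sub h2).congr_deriv (sub_self _)
    have hconst := is_const_of_deriv_eq_zero (fun t => (hd t).differentiableAt)
      (fun t => (hd t).deriv) t 0
    rw [← sub_eq_zero, hconst, Finset.sum_range_succ' _ N]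
    have e0 : lieExp (E := E) (G := G) ((0 : ℝ) • Y) = 1 := by
      rw [zero_smul]
      exact lieExp_zero
    rw [e0, Ad_one]
    simp

theorem Ad_lieExp_one [CompleteSpace E] (Y : E) {n : ℕ} {X : E}
    (h : (bracketE E G Y)^[n] X = 0) : Ad E (lieExp (E := E) (G := G) Y) X =
      ∑ i ∈ Finset.range n, (i.factorial : ℝ)⁻¹ • (bracketE E G Y)^[i] X := by
  have := Ad_lieExp_eq_sum (G := G) Y n X h 1
  rw [one_smul] at this
  simpa using this

variable (E G) in
/-- The adjoint representation as an endomorphism of the Lie algebra. -/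
def adRep (g : G) : Module.End ℝ (GroupLieAlgebra 𝓘(ℝ, E) G) := (Ad E g : E →ₗ[ℝ] E)

omit [FiniteDimensional ℝ E] [T2Space G] in
theorem adRep_mul (g h : G) : adRep E G (g * h) = adRep E G g * adRep E G h :=
  congrArg (fun T : E →L[ℝ] E => (T : E →ₗ[ℝ] E)) (Ad_mul (E := E) g h)

omit [FiniteDimensional ℝ E] [LieGroup 𝓘(ℝ, E) ∞ G] [T2Space G] in
theorem adRep_one : adRep E G 1 = 1 :=
  congrArg (fun T : E →L[ℝ] E => (T : E →ₗ[ℝ] E)) (Ad_one (E := E) (G := G))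

variable [CompleteSpace E] [LieGroup 𝓘(ℝ, E) (minSmoothness ℝ 3) G]
  (S : Stratification (GroupLieAlgebra 𝓘(ℝ, E) G))

/-- On the ideal `𝔤` of `𝔤 ⊕ ℝδ`, the exponential of `extAd Y` is the adjoint action of `exp Y`. -/
theorem nilExp_extAd_apply {Y : GroupLieAlgebra 𝓘(ℝ, E) G} (hY : IsNilpotent (S.extAd Y))
    (X : GroupLieAlgebra 𝓘(ℝ, E) G) :
    nilExp (S.extAd Y) (X, 0) = (adRep E G (lieExp Y) X, 0) := by
  obtain ⟨n, hn⟩ := hY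
  set B : GroupLieAlgebra 𝓘(ℝ, E) G → GroupLieAlgebra 𝓘(ℝ, E) G := fun Z => ⁅Y, Z⁆ with hB
  have step : ∀ Z, S.extAd Y (Z, 0) = (B Z, 0) :=
    fun Z => Prod.ext (sub_eq_self.2 (zero_smul _ _)) rfl
  have hpow : ∀ i, (S.extAd Y ^ i) (X, 0) = (B^[i] X, 0) := by
    intro i
    induction i with
    | zero => rfl
    | succ i ih => rw [pow_succ', Module.End.mul_apply, ih, Function.iterate_succ_apply', step]
  have h0 : B^[n] X = 0 := by
    have := hpow n
    rw [hn] at this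
    exact (congrArg Prod.fst this).symm
  have h2 : adRep E G (lieExp Y) X = ∑ i ∈ Finset.range n, (i.factorial : ℝ)⁻¹ • B^[i] X :=
    Ad_lieExp_one (E := E) (G := G) Y h0
  rw [h2, nilExp_eq_sum hn, LinearMap.sum_apply]
  simp only [LinearMap.smul_apply, hpow]
  ext
  · simp [Prod.fst_sum]
  · simp [Prod.snd_sum]

variable {S}

omit [FiniteDimensional ℝ E] [LieGroup 𝓘(ℝ, E) ∞ G] [T2Space G] in
theorem isNilpotent_extAd {j : ℕ} {Y : GroupLieAlgebra 𝓘(ℝ, E) G} (hY : Y ∈ S.layer j) :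
    IsNilpotent (S.extAd Y) := by
  rcases Nat.eq_zero_or_pos j with rfl | hj
  · rw [S.layer_zero, Submodule.mem_bot] at hY
    rw [hY, map_zero]
    exact IsNilpotent.zero
  · exact DilationFiltration.isNilpotent hj (Stratification.extAd_mem_homog hY).1

omit [FiniteDimensional ℝ E] [LieGroup 𝓘(ℝ, E) ∞ G] [T2Space G] in
/-- The action on the grading derivation: the series stops after the linear term, as `Y` commutes
with `[Y, δ] = -j Y`. -/
theorem nilExp_neg_extAd_apply {j : ℕ} {Y : GroupLieAlgebra 𝓘(ℝ, E) G} (hY : Y ∈ S.layer j) :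
    nilExp (-S.extAd Y) (0, 1) = ((j : ℝ) • Y, 1) := by
  have h1 : (-S.extAd Y) (0, 1) = ((j : ℝ) • Y, 0) := by
    rw [LinearMap.neg_apply, Stratification.extAd_apply, Stratification.deriv_apply hY]
    ext <;> simp
  have h2 : (-S.extAd Y) ((j : ℝ) • Y, 0) = 0 := by
    rw [LinearMap.neg_apply, Stratification.extAd_apply]
    ext <;> simp
  have h3 : ∀ i, ((-S.extAd Y) ^ (i + 2)) (0, 1) = 0 := by
    intro i
    rw [pow_add, pow_two, Module.End.mul_apply, Module.End.mul_apply, h1, h2, map_zero]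
  obtain ⟨n, hn⟩ := (isNilpotent_extAd hY).neg
  have hn' : (-S.extAd Y) ^ (n + 2) = 0 := by rw [pow_add, hn, zero_mul]
  rw [nilExp_eq_sum hn', LinearMap.sum_apply, Finset.sum_range_succ', Finset.sum_range_succ']
  simp [h3, h1]

/-- The left velocity of the dilated product, read off from the action of the corresponding
product in the algebra on the grading derivation. -/
theorem exists_hasVel_prod (l : List (ℕ × GroupLieAlgebra 𝓘(ℝ, E) G))
    (hl : ∀ p ∈ l, p.2 ∈ S.layer p.1) (s : ℝ) : ∃ v : GroupLieAlgebra 𝓘(ℝ, E) G,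
      HasVel (E := E) (fun s => (l.map fun p => lieExp (Real.exp s ^ p.1 • p.2)).prod) v s ∧
      (l.map fun p => nilExp (-S.extAd (Real.exp s ^ p.1 • p.2))).reverse.prod (0, 1) = (v, 1) ∧
      ∀ X, (l.map fun p => nilExp (-S.extAd (Real.exp s ^ p.1 • p.2))).reverse.prod (X, 0) =
        (adRep E G (l.map fun p => lieExp (Real.exp s ^ p.1 • p.2)).prod⁻¹ X, 0) := by
  induction l with
  | nil => exact ⟨0, hasVel_const 1 s, rfl, fun X => by simp [adRep_one]⟩
  | cons p l ih =>
    obtain ⟨v, hv, hv1, hv0⟩ := ih fun q hq => hl q (List.mem_cons_of_mem _ hq)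
    have hp := (S.layer p.1).smul_mem (Real.exp s ^ p.1) (hl p List.mem_cons_self)
    set u : GroupLieAlgebra 𝓘(ℝ, E) G := (p.1 : ℝ) • Real.exp s ^ p.1 • p.2 with hu
    have hvel : HasVel (E := E) (fun s => lieExp (Real.exp s ^ p.1 • p.2)) u s := by
      refine (HasVel.comp (b := fun s => Real.exp s ^ p.1) (hasVel_lieExp p.2 _)
        ((Real.hasDerivAt_exp s).pow p.1)).congr_vel ?_
      have goal : (p.1 * Real.exp s ^ (p.1 - 1) * Real.exp s) • p.2 = u := by
        rw [hu, smul_smul]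
        rcases Nat.eq_zero_or_pos p.1 with h | h
        · simp [h]
        · rw [mul_assoc, pow_sub_one_mul h.ne']
      exact goal
    refine ⟨adRep E G (l.map fun p => lieExp (Real.exp s ^ p.1 • p.2)).prod⁻¹ u + v, ?_, ?_, ?_⟩
    · simp only [List.map_cons, List.prod_cons]
      exact hvel.mul hv
    · rw [List.map_cons, List.reverse_cons, List.prod_append, List.prod_singleton,
        Module.End.mul_apply, nilExp_neg_extAd_apply hp]
      have e : ((u, 1) : GroupLieAlgebra 𝓘(ℝ, E) G × ℝ) = (u, 0) + (0, 1) := by simp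
      rw [e, map_add, hv0, hv1]
      simp
    · intro X
      rw [List.map_cons, List.reverse_cons, List.prod_append, List.prod_singleton,
        Module.End.mul_apply, ← map_neg, nilExp_extAd_apply S
        (isNilpotent_extAd ((S.layer p.1).neg_mem hp)), hv0, lieExp_neg, List.map_cons,
        List.prod_cons, mul_inv_rev, adRep_mul, Module.End.mul_apply]

/-- A relation between the exponentials of homogeneous elements in the algebra holds in the group
as well. The dilated products in the algebra are trivial, so the dilated product in the group has
velocity zero, and it tends to `1` as the dilation factor tends to `0`. -/
theorem prod_lieExp_eq_one (l : List (ℕ × GroupLieAlgebra 𝓘(ℝ, E) G))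
    (hl : ∀ p ∈ l, p.2 ∈ S.layer p.1) (h : (l.map fun p => nilExp (S.extAd p.2)).prod = 1) :
    (l.map fun p => lieExp p.2).prod = 1 := by
  have hT : ∀ s : ℝ, (l.map fun p => nilExp (S.extAd (Real.exp s ^ p.1 • p.2))).prod = 1 := by
    intro s
    rw [← map_one (S.endFiltration.dil (Real.exp s)), ← h, map_list_prod, List.map_map]
    congr 1
    refine List.map_congr_left fun p hp => ?_
    rw [Function.comp_apply, map_nilExp (isNilpotent_extAd (hl p hp)),
      (Stratification.extAd_mem_homog (hl p hp)).2.2 _ (Real.exp_pos s).ne', map_smul]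
  have hQT : ∀ (s : ℝ) (l : List (ℕ × GroupLieAlgebra 𝓘(ℝ, E) G)),
      (∀ p ∈ l, p.2 ∈ S.layer p.1) →
      (l.map fun p => nilExp (-S.extAd (Real.exp s ^ p.1 • p.2))).reverse.prod *
        (l.map fun p => nilExp (S.extAd (Real.exp s ^ p.1 • p.2))).prod = 1 := by
    intro s l hl
    induction l with
    | nil => simp
    | cons p l ih =>
      have hp := (S.layer p.1).smul_mem (Real.exp s ^ p.1) (hl p List.mem_cons_self)
      rw [List.map_cons, List.map_cons, List.reverse_cons, List.prod_append, List.prod_singleton,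
        List.prod_cons, mul_assoc, ← mul_assoc (nilExp (-_)),
        nilExp_neg_mul (isNilpotent_extAd hp), one_mul,
        ih fun q hq => hl q (List.mem_cons_of_mem _ hq)]
  set W : ℝ → G := fun r => (l.map fun p => lieExp (r ^ p.1 • p.2)).prod with hW
  have hvel : ∀ s, HasVel (E := E) (fun s => W (Real.exp s)) 0 s := by
    intro s
    obtain ⟨v, hv, hv1, -⟩ := exists_hasVel_prod l hl s
    have := hQT s l hl
    rw [hT s, mul_one] at this
    rw [this] at hv1
    exact hv.congr_vel (congrArg Prod.fst hv1).symm
  have hconst : (fun s => W (Real.exp s)) = fun _ => W 1 :=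
    eq_of_hasVel (t₀ := 0) hvel (hasVel_const (W 1)) (by simp)
  have hW1 : W 1 = (l.map fun p => lieExp p.2).prod := by simp [hW]
  have hW0 : W 0 = 1 := by
    refine List.prod_eq_one fun x hx => ?_
    obtain ⟨p, hp, rfl⟩ := List.mem_map.1 hx
    have : (0 : ℝ) ^ p.1 • p.2 = 0 := by
      rcases Nat.eq_zero_or_pos p.1 with h | h
      · have := hl p hp
        rw [h, S.layer_zero, Submodule.mem_bot] at this
        rw [this, smul_zero]
      · rw [zero_pow h.ne', zero_smul]
    rw [this, lieExp_zero]
  have hcont : Continuous W := by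
    have : ContinuousMul G := continuousMul_of_contMDiffMul 𝓘(ℝ, E) ∞
    refine continuous_list_prod l fun p hp => ?_
    have : Continuous fun t : ℝ => lieExp (t • p.2) :=
      continuous_iff_continuousAt.2 fun t => (hasVel_lieExp p.2 t).continuousAt
    exact this.comp (continuous_pow p.1)
  have h1 : Filter.Tendsto (fun s => W (Real.exp s)) Filter.atBot (𝓝 (W 0)) :=
    hcont.continuousAt.tendsto.comp Real.tendsto_exp_atBot
  rw [hconst] at h1
  rw [← hW1, ← hW0]
  exact tendsto_nhds_unique tendsto_const_nhds h1

end Transfer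

/-! ### The first layer generates the group -/

section Generation

variable {E : Type*} [NormedAddCommGroup E] [NormedSpace ℝ E] [FiniteDimensional ℝ E]
  {G : Type*} [TopologicalSpace G] [ChartedSpace E G] [Group G] [LieGroup 𝓘(ℝ, E) ∞ G]
  [T2Space G] [CompleteSpace E] [LieGroup 𝓘(ℝ, E) (minSmoothness ℝ 3) G]
  (S : Stratification (GroupLieAlgebra 𝓘(ℝ, E) G))

/-- The subgroup generated by the exponentials of the elements of the first layer. -/
def horizontalSubgroup : Subgroup G :=
  Subgroup.closure {g | ∃ X ∈ S.layer 1, lieExp X = g}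

variable {S}

theorem exists_word_of_mem_horizontalSubgroup {g : G} (hg : g ∈ horizontalSubgroup S) :
    ∃ w : List (S.layer 1), (w.map fun X : S.layer 1 => lieExp (X : GroupLieAlgebra 𝓘(ℝ, E) G)).prod = g := by
  induction hg using Subgroup.closure_induction'' with
  | one => exact ⟨[], rfl⟩
  | mem g hg =>
    obtain ⟨X, hX, rfl⟩ := hg
    exact ⟨[⟨X, hX⟩], by simp⟩
  | inv_mem g hg =>
    obtain ⟨X, hX, rfl⟩ := hg
    exact ⟨[-⟨X, hX⟩], by simp [lieExp_neg]⟩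
  | mul g h _ _ hg hh =>
    obtain ⟨u, rfl⟩ := hg
    obtain ⟨w, rfl⟩ := hh
    exact ⟨u ++ w, by simp⟩

theorem prod_mem_horizontalSubgroup (w : List (S.layer 1)) :
    (w.map fun X : S.layer 1 => lieExp (X : GroupLieAlgebra 𝓘(ℝ, E) G)).prod ∈ horizontalSubgroup S := by
  refine Subgroup.list_prod_mem _ fun g hg => ?_
  obtain ⟨X, -, rfl⟩ := List.mem_map.1 hg
  exact Subgroup.subset_closure ⟨X, X.2, rfl⟩

/-- The exponential of a homogeneous element is a product of exponentials of elements of the first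
layer: this holds in the algebra, and is transferred to the group. -/
theorem lieExp_mem_of_mem_layer {j : ℕ} {Y : GroupLieAlgebra 𝓘(ℝ, E) G} (hY : Y ∈ S.layer j) :
    lieExp Y ∈ horizontalSubgroup S := by
  rcases Nat.eq_zero_or_pos j with rfl | hj
  · rw [S.layer_zero, Submodule.mem_bot] at hY
    rw [hY, lieExp_zero]
    exact one_mem _
  obtain ⟨w, hw⟩ := exists_wordExp_eq_nilExp (Stratification.range_firstAd_le (S := S)) hj
    (Stratification.extAd_mem_lieLayer hY)
  have h := prod_lieExp_eq_one (S := S)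
    ((w.map fun X : S.layer 1 => (1, (X : GroupLieAlgebra 𝓘(ℝ, E) G))) ++ [(j, -Y)]) (by
      intro p hp
      rcases List.mem_append.1 hp with hp | hp
      · obtain ⟨X, -, rfl⟩ := List.mem_map.1 hp
        exact X.2
      · rw [List.mem_singleton.1 hp]
        exact neg_mem hY) (by
      have e : (w.map fun X : S.layer 1 => nilExp (S.extAd (X : GroupLieAlgebra 𝓘(ℝ, E) G))).prod =
          nilExp (S.extAd Y) := hw
      rw [List.map_append, List.prod_append, List.map_map]
      simp only [Function.comp_def, List.map_cons, List.map_nil, List.prod_singleton]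
      rw [e, map_neg, nilExp_mul_neg (isNilpotent_extAd hY)])
  rw [List.map_append, List.prod_append, List.map_map] at h
  simp only [Function.comp_def, List.map_cons, List.map_nil, List.prod_singleton, lieExp_neg] at h
  rw [← mul_inv_eq_one.1 h]
  exact prod_mem_horizontalSubgroup w

omit [FiniteDimensional ℝ E] [LieGroup 𝓘(ℝ, E) ∞ G] [T2Space G] in
theorem exists_iterate_bracketE_eq_zero {j : ℕ} {Y : GroupLieAlgebra 𝓘(ℝ, E) G}
    (hY : Y ∈ S.layer j) : ∃ n, ∀ X : E, (bracketE E G Y)^[n] X = 0 := by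
  obtain ⟨n, hn⟩ := isNilpotent_extAd hY
  set B : GroupLieAlgebra 𝓘(ℝ, E) G → GroupLieAlgebra 𝓘(ℝ, E) G := fun Z => ⁅Y, Z⁆ with hB
  have hpow : ∀ i (X : GroupLieAlgebra 𝓘(ℝ, E) G), (S.extAd Y ^ i) (X, 0) = (B^[i] X, 0) := by
    intro i X
    induction i with
    | zero => rfl
    | succ i ih =>
      rw [pow_succ', Module.End.mul_apply, ih, Function.iterate_succ_apply']
      exact Prod.ext (sub_eq_self.2 (zero_smul _ _)) rfl
  refine ⟨n, fun X => ?_⟩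
  have := hpow n X
  rw [hn] at this
  exact (congrArg Prod.fst this).symm

omit [LieGroup 𝓘(ℝ, E) ∞ G] [T2Space G] in
theorem continuous_bracketE (Y : E) : Continuous (bracketE E G Y) :=
  let f : E →ₗ[ℝ] E := LieAlgebra.ad ℝ (GroupLieAlgebra 𝓘(ℝ, E) G) Y
  f.continuous_of_finiteDimensional

theorem continuous_Ad_lieExp {e : E} {n : ℕ} (hn : ∀ X : E, (bracketE E G e)^[n] X = 0)
    {b : ℝ → ℝ} (hb : Continuous b) {V : ℝ → E} (hV : Continuous V) :
    Continuous fun t => Ad E (lieExp (E := E) (G := G) (b t • e)) (V t) := by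
  rw [funext fun t => Ad_lieExp_eq_sum (G := G) e n (V t) (hn _) (b t)]
  exact continuous_finsetSum _ fun i _ => ((hb.pow i).div_const _).smul
    (((continuous_bracketE (G := G) e).iterate i).comp hV)

theorem adRep_lieExp_mem {h : Submodule ℝ (GroupLieAlgebra 𝓘(ℝ, E) G)}
    (hideal : ∀ X : GroupLieAlgebra 𝓘(ℝ, E) G, ∀ Y ∈ h, ⁅X, Y⁆ ∈ h) {j : ℕ}
    {e v : GroupLieAlgebra 𝓘(ℝ, E) G} (he : e ∈ S.layer j) (hv : v ∈ h) (r : ℝ) :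
    adRep E G (lieExp (r • e)) v ∈ h := by
  obtain ⟨n, hn⟩ := exists_iterate_bracketE_eq_zero he
  have hsum := Ad_lieExp_eq_sum (G := G) (E := E) e n v (hn _) r
  have hmem : ∀ i, (fun Z : GroupLieAlgebra 𝓘(ℝ, E) G => ⁅e, Z⁆)^[i] v ∈ h := by
    intro i
    induction i with
    | zero => exact hv
    | succ i ih =>
      rw [Function.iterate_succ_apply']
      exact hideal e _ ih
  have hs : (∑ i ∈ Finset.range n, (r ^ i / i.factorial : ℝ) •
      (fun Z : GroupLieAlgebra 𝓘(ℝ, E) G => ⁅e, Z⁆)^[i] v) ∈ h :=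
    Submodule.sum_mem h fun i _ => h.smul_mem _ (hmem i)
  exact (congrArg (· ∈ h) hsum).mpr hs

omit [CompleteSpace E] [LieGroup 𝓘(ℝ, E) (minSmoothness ℝ 3) G] in
theorem HasVel.mul_lieExp {e : E} {c : ℝ → G} {b : ℝ → ℝ} {a t : ℝ} {A : E}
    (hb : HasDerivAt b a t)
    (hc : HasVel c (Ad E (lieExp (E := E) (G := G) (b t • e)) (A - a • e)) t) :
    HasVel (fun s => c s * lieExp (E := E) (G := G) (b s • e)) A t := by
  have h1 := HasVel.comp (hasVel_lieExp (E := E) (G := G) e (b t)) hb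
  refine (hc.mul h1).congr_vel ?_
  have h2 := congrArg (fun T : E →L[ℝ] E => T (A - a • e))
    (Ad_inv_mul (E := E) (lieExp (E := E) (G := G) (b t • e)))
  exact (congrArg (· + a • e) h2).trans (sub_add_cancel A (a • e))

variable (S) in
/-- Every continuous velocity with values in `h` is the left velocity of a curve in the horizontal
subgroup. -/
def IsIntegrable (h : Submodule ℝ (GroupLieAlgebra 𝓘(ℝ, E) G)) : Prop :=
  ∀ A : ℝ → E, Continuous A → (∀ t, A t ∈ h) → ∃ c : ℝ → G, c 0 = 1 ∧
    (∀ t, HasVel c (A t) t) ∧ ∀ t, c t ∈ horizontalSubgroup S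

/-- Integrability passes from an ideal to its sum with a line spanned by a homogeneous element `e`:
the curve is sought in the form `c t * exp (b t • e)`. -/
theorem IsIntegrable.sup_span {h : Submodule ℝ (GroupLieAlgebra 𝓘(ℝ, E) G)}
    (hh : IsIntegrable S h) (hideal : ∀ X : GroupLieAlgebra 𝓘(ℝ, E) G, ∀ Y ∈ h, ⁅X, Y⁆ ∈ h)
    {j : ℕ} {e : GroupLieAlgebra 𝓘(ℝ, E) G} (he : e ∈ S.layer j) (heh : e ∉ h) :
    IsIntegrable S (h ⊔ Submodule.span ℝ {e}) := by
  intro A hA hAh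
  obtain ⟨f, hfe, hfh⟩ : ∃ f : GroupLieAlgebra 𝓘(ℝ, E) G →ₗ[ℝ] ℝ, f e = 1 ∧ ∀ x ∈ h, f x = 0 := by
    obtain ⟨f, hf, hfh⟩ := Submodule.exists_le_ker_of_notMem heh
    refine ⟨(f e)⁻¹ • f, by simp [hf], fun x hx => ?_⟩
    have : f x = 0 := hfh hx
    simp [this]
  -- `f` reads off the coefficient of `e`
  have hVh : ∀ x : GroupLieAlgebra 𝓘(ℝ, E) G, x ∈ h ⊔ Submodule.span ℝ {e} → x - f x • e ∈ h := by
    intro x hx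
    obtain ⟨y, hy, z, hz, rfl⟩ := Submodule.mem_sup.1 hx
    obtain ⟨r, rfl⟩ := Submodule.mem_span_singleton.1 hz
    rw [map_add, hfh y hy, map_smul, hfe]
    simpa using hy
  set a : ℝ → ℝ := fun t => f (A t) with ha
  have hac : Continuous a :=
    have hf : Continuous (f : E → ℝ) :=
      let f' : E →ₗ[ℝ] ℝ := f
      f'.continuous_of_finiteDimensional
    hf.comp hA
  set b : ℝ → ℝ := fun t => ∫ s in (0 : ℝ)..t, a s with hb
  have hbd : ∀ t, HasDerivAt b (a t) t := fun t =>
    intervalIntegral.integral_hasDerivAt_right (hac.intervalIntegrable 0 t)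
      hac.aestronglyMeasurable.stronglyMeasurableAtFilter hac.continuousAt
  have hbc : Continuous b := continuous_iff_continuousAt.2 fun t => (hbd t).continuousAt
  obtain ⟨n, hn⟩ := exists_iterate_bracketE_eq_zero he
  have hVc : Continuous fun t => (HSub.hSub (α := E) (β := E) (A t) (HSMul.hSMul (β := E) (a t) e)) :=
    hA.sub (hac.smul continuous_const)
  obtain ⟨c, hc0, hc, hcS⟩ := hh _ (continuous_Ad_lieExp (G := G) hn hbc hVc)
    fun t => adRep_lieExp_mem hideal he (hVh (A t) (hAh t)) (b t)
  refine ⟨fun t => c t * lieExp (E := E) (G := G) (b t • e), ?_, fun t => ?_, fun t =>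
    mul_mem (hcS t) (lieExp_mem_of_mem_layer ((S.layer j).smul_mem (b t) he))⟩
  · simp [hc0, hb, lieExp_zero]
  · exact HasVel.mul_lieExp (E := E) (e := e) (hbd t) (hc t)

theorem isIntegrable_bot : IsIntegrable S ⊥ := by
  intro A _ hAh
  refine ⟨fun _ => 1, rfl, fun t => ?_, fun t => one_mem _⟩
  have h0 : ∀ X : GroupLieAlgebra 𝓘(ℝ, E) G,
      X ∈ (⊥ : Submodule ℝ (GroupLieAlgebra 𝓘(ℝ, E) G)) → X = 0 :=
    fun X hX => (Submodule.mem_bot ℝ).1 hX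
  exact (hasVel_const 1 t).congr_vel (h0 _ (hAh t)).symm

/-- A maximal integrable ideal is everything: otherwise it can be enlarged by an element of the last
layer that it does not contain, whose brackets lie in deeper layers. -/
theorem isIntegrable_top : IsIntegrable S ⊤ := by
  have : FiniteDimensional ℝ (GroupLieAlgebra 𝓘(ℝ, E) G) :=
    inferInstanceAs (FiniteDimensional ℝ E)
  obtain ⟨h, ⟨hint, hideal⟩, hmax⟩ := (wellFounded_gt
    (α := Submodule ℝ (GroupLieAlgebra 𝓘(ℝ, E) G))).has_min
    {h | IsIntegrable S h ∧ ∀ X : GroupLieAlgebra 𝓘(ℝ, E) G, ∀ Y ∈ h, ⁅X, Y⁆ ∈ h}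
    ⟨⊥, isIntegrable_bot, fun X Y hY => by
      rw [(Submodule.mem_bot ℝ).1 hY, lie_zero]
      exact zero_mem _⟩
  by_cases htop : h = ⊤
  · exact htop ▸ hint
  exfalso
  -- the last layer that is not contained in `h`
  obtain ⟨m, hm⟩ : ∃ m, ¬ S.layer m ≤ h := by
    by_contra! hcon
    refine htop (eq_top_iff.2 ?_)
    rw [← S.isInternal.submodule_iSup_eq_top]
    exact iSup_le hcon
  classical
  set k := Nat.findGreatest (fun k => ¬ S.layer k ≤ h) S.step with hk
  have hms : m ≤ S.step := by
    by_contra! hlt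
    exact hm (by rw [S.layer_of_step_lt m hlt]; exact bot_le)
  have hkh : ¬ S.layer k ≤ h := Nat.findGreatest_spec (P := fun k => ¬ S.layer k ≤ h) hms hm
  have hlast : ∀ i, k < i → S.layer i ≤ h := by
    intro i hi
    rcases le_or_gt i S.step with his | his
    · exact not_not.1 (Nat.findGreatest_is_greatest hi his)
    · rw [S.layer_of_step_lt i his]; exact bot_le
  obtain ⟨e, he, heh⟩ := SetLike.not_le_iff_exists.1 hkh
  refine hmax (h ⊔ Submodule.span ℝ {e}) ⟨hint.sup_span hideal he heh, ?_⟩ ?_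
  · intro X Y hY
    obtain ⟨x, hx, y, hy, rfl⟩ := Submodule.mem_sup.1 hY
    obtain ⟨r, rfl⟩ := Submodule.mem_span_singleton.1 hy
    rw [lie_add, lie_smul]
    refine Submodule.mem_sup_left (add_mem (hideal X x hx) (h.smul_mem r ?_))
    refine S.layer_induction (p := fun X => ⁅X, e⁆ ∈ h) X (fun i X hX => ?_) fun X X' h1 h2 => by
      rw [add_lie]; exact add_mem h1 h2
    rcases Nat.eq_zero_or_pos i with rfl | hi
    · rw [S.layer_zero, Submodule.mem_bot] at hX
      rw [hX, zero_lie]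
      exact zero_mem _
    · exact hlast (i + k) (by omega) (Stratification.lie_mem_layer hX he)
  · refine lt_of_le_of_ne le_sup_left fun heq => heh ?_
    rw [heq]
    exact Submodule.mem_sup_right (Submodule.mem_span_singleton_self e)

/-- Every exponential is a product of exponentials of elements of the first layer. -/
theorem lieExp_mem_horizontalSubgroup (X : GroupLieAlgebra 𝓘(ℝ, E) G) :
    lieExp X ∈ horizontalSubgroup S := by
  obtain ⟨c, hc0, hc, hcS⟩ := isIntegrable_top (S := S) (fun _ => X) continuous_const
    fun _ => trivial
  have := eq_lieExp_of_hasVel hc0 hc 1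
  rw [one_smul] at this
  exact this ▸ hcS 1

end Generation

/-! ### Curves that follow words, and their lengths -/

section Curves

variable {E : Type*} [NormedAddCommGroup E] [NormedSpace ℝ E]
  {G : Type*} [TopologicalSpace G] [ChartedSpace E G] [Group G] [LieGroup 𝓘(ℝ, E) ∞ G]

variable (G) in
/-- The left-invariant vector field equal to `v` at the identity, read in the chart at `x`. -/
def chartVel (x : G) (v : E) (g : G) : E :=
  (mfderiv 𝓘(ℝ, E) 𝓘(ℝ, E) (extChartAt 𝓘(ℝ, E) x) g : E →L[ℝ] E) (dL E g v)

theorem continuousOn_chartVel [CompleteSpace E] [LieGroup 𝓘(ℝ, E) (minSmoothness ℝ 3) G]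
    (x : G) (v : E) : ContinuousOn (chartVel G x v) (chartAt E x).source := by
  have := isManifold_one (E := E) (G := G)
  have hv : Continuous (fun g : G => (⟨g, mulInvariantVectorField
      (v : GroupLieAlgebra 𝓘(ℝ, E) G) g⟩ : TangentBundle 𝓘(ℝ, E) G)) :=
    (contMDiff_mulInvariantVectorField (v : GroupLieAlgebra 𝓘(ℝ, E) G)).continuous
  set e := trivializationAt E (TangentSpace 𝓘(ℝ, E) : G → Type _) x with he
  have h1 : ContinuousOn (fun g : G => (e ⟨g, mulInvariantVectorField
      (v : GroupLieAlgebra 𝓘(ℝ, E) G) g⟩).2) (chartAt E x).source := by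
    refine continuous_snd.comp_continuousOn (e.continuousOn.comp hv.continuousOn fun g hg => ?_)
    rw [e.mem_source]
    exact hg
  refine h1.congr fun g hg => ?_
  have h2 := TangentBundle.continuousLinearMapAt_trivializationAt (I := 𝓘(ℝ, E)) (x₀ := x) hg
  have h3 : e.continuousLinearMapAt ℝ g (mulInvariantVectorField
      (v : GroupLieAlgebra 𝓘(ℝ, E) G) g) =
      (e ⟨g, mulInvariantVectorField (v : GroupLieAlgebra 𝓘(ℝ, E) G) g⟩).2 := by
    rw [Bundle.Trivialization.continuousLinearMapAt_apply,
      Bundle.Trivialization.coe_linearMapAt_of_mem _ (show g ∈ e.baseSet from hg)]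
  exact (congrArg (fun T : E →L[ℝ] E => T (dL E g v)) h2).symm.trans h3

/-- A curve, read in a chart, has the expected derivative. -/
theorem HasVel.hasDerivAt_chart {c : ℝ → G} {v : E} {t : ℝ} (hc : HasVel c v t) {x : G}
    (hx : c t ∈ (chartAt E x).source) :
    HasDerivAt (fun s => chartAt E x (c s)) (chartVel G x v (c t)) t := by
  have := isManifold_one (E := E) (G := G)
  have h1 := (mdifferentiableAt_extChartAt (I := 𝓘(ℝ, E)) hx).hasMFDerivAt
  set D : E →L[ℝ] E := mfderiv 𝓘(ℝ, E) 𝓘(ℝ, E) (extChartAt 𝓘(ℝ, E) x) (c t) with hD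
  have h2 : HasFDerivAt (fun s => chartAt E x (c s))
      (D.comp ((1 : ℝ →L[ℝ] ℝ).smulRight (dL E (c t) v))) t :=
    hasMFDerivAt_iff_hasFDerivAt.1 (HasMFDerivAt.comp t h1 hc)
  have h3 : (D.comp ((1 : ℝ →L[ℝ] ℝ).smulRight (dL E (c t) v))) 1 = D (dL E (c t) v) := by simp
  exact h2.hasDerivAt.congr_deriv h3

/-- A continuous curve that has, at every time, a right velocity, taken from a finite set, is
absolutely continuous: it is Lipschitz in every chart. -/
theorem absCont_of_right_vel [CompleteSpace E] [LieGroup 𝓘(ℝ, E) (minSmoothness ℝ 3) G]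
    {γ : ℝ → G} (hγ : Continuous γ) (l : List E)
    (h : ∀ t, ∃ v ∈ l, ∃ c : ℝ → G, HasVel c v t ∧ γ =ᶠ[𝓝[≥] t] c) (a b : ℝ) :
    AbsCont E γ a b := by
  refine ⟨hγ.continuousOn, fun x p q _ hpq _ hmaps => ?_⟩
  have hcpt : IsCompact (γ '' Icc p q) := isCompact_Icc.image hγ
  have hsub : γ '' Icc p q ⊆ (chartAt E x).source := hmaps.image_subset
  obtain ⟨C, hC⟩ : ∃ C : ℝ, ∀ v ∈ l, ∀ g ∈ γ '' Icc p q, ‖chartVel G x v g‖ ≤ C := by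
    clear h
    induction l with
    | nil => exact ⟨0, by simp⟩
    | cons v l ih =>
      obtain ⟨C, hC⟩ := ih
      obtain ⟨D, hD⟩ := hcpt.exists_bound_of_continuousOn ((continuousOn_chartVel x v).mono hsub)
      refine ⟨max C D, fun w hw g hg => ?_⟩
      rcases List.mem_cons.1 hw with rfl | hw
      · exact (hD g hg).trans (le_max_right _ _)
      · exact (hC w hw g hg).trans (le_max_left _ _)
  choose f' hf'l c hc hcγ using h
  have hd : ∀ t ∈ Icc p q, HasDerivWithinAt (fun s => chartAt E x (γ s))
      (chartVel G x (f' t) (γ t)) (Ici t) t := by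
    intro t ht
    have hct : γ t = c t t := (hcγ t).self_of_nhdsWithin self_mem_Ici
    have hx : c t t ∈ (chartAt E x).source := hct ▸ hmaps ht
    have := ((hc t).hasDerivAt_chart hx).hasDerivWithinAt (s := Ici t)
    rw [hct]
    exact this.congr_of_eventuallyEq ((hcγ t).fun_comp (chartAt E x)) (by rw [hct])
  have hcont : ContinuousOn (fun s => chartAt E x (γ s)) (Icc p q) :=
    (chartAt E x).continuousOn.comp hγ.continuousOn hmaps
  have hle : ∀ s ∈ Icc p q, ∀ t ∈ Icc p q, s ≤ t →
      ‖chartAt E x (γ t) - chartAt E x (γ s)‖ ≤ C * (t - s) := by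
    intro s hs t ht hst
    refine norm_image_sub_le_of_norm_deriv_right_le_segment
      (f' := fun u => chartVel G x (f' u) (γ u))
      (hcont.mono (Icc_subset_Icc hs.1 ht.2)) (fun u hu => hd u ⟨hs.1.trans hu.1, hu.2.le.trans ht.2⟩)
      (fun u hu => hC _ (hf'l u) _ (mem_image_of_mem _ ⟨hs.1.trans hu.1, hu.2.le.trans ht.2⟩)) t
      ⟨hst, le_rfl⟩
  have hlip : LipschitzOnWith C.toNNReal (fun s => chartAt E x (γ s)) (uIcc p q) := by
    rw [uIcc_of_le hpq]
    have hC0 : C ≤ C.toNNReal := Real.le_coe_toNNReal C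
    refine LipschitzOnWith.of_dist_le_mul fun s hs t ht => ?_
    rw [Real.dist_eq]
    rcases le_total s t with hst | hst
    · rw [dist_comm, dist_eq_norm, abs_sub_comm, abs_of_nonneg (sub_nonneg.2 hst)]
      exact (hle s hs t ht hst).trans (mul_le_mul_of_nonneg_right hC0 (sub_nonneg.2 hst))
    · rw [dist_eq_norm, abs_of_nonneg (sub_nonneg.2 hst)]
      exact (hle t ht s hs hst).trans (mul_le_mul_of_nonneg_right hC0 (sub_nonneg.2 hst))
  exact hlip.absolutelyContinuousOnInterval

variable [FiniteDimensional ℝ E] [T2Space G]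

/-- The curve that follows the one-parameter groups of the letters of a word, one after the other,
each for one unit of time. -/
def wordCurve : List (GroupLieAlgebra 𝓘(ℝ, E) G) → ℝ → G
  | [], _ => 1
  | Y :: w, t => if t ≤ 1 then lieExp (t • Y) else lieExp Y * wordCurve w (t - 1)

/-- The left velocity of `wordCurve`, except at the corners. -/
def wordVel : List (GroupLieAlgebra 𝓘(ℝ, E) G) → ℝ → GroupLieAlgebra 𝓘(ℝ, E) G
  | [], _ => 0
  | Y :: w, t => if t < 1 then Y else wordVel w (t - 1)

theorem wordCurve_zero : ∀ w : List (GroupLieAlgebra 𝓘(ℝ, E) G), wordCurve w 0 = 1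
  | [] => rfl
  | Y :: w => by simp [wordCurve, lieExp_zero]

theorem wordCurve_length (w : List (GroupLieAlgebra 𝓘(ℝ, E) G)) :
    wordCurve w w.length = (w.map lieExp).prod := by
  induction w with
  | nil => rfl
  | cons Y w ih =>
    rw [wordCurve, List.map_cons, List.prod_cons, List.length_cons, ← ih]
    push_cast
    rw [add_sub_cancel_right]
    split_ifs with h
    · have : w = [] := by
        rw [← List.length_eq_zero_iff]
        have : (w.length : ℝ) ≤ 0 := by linarith
        exact_mod_cast le_antisymm this (Nat.cast_nonneg _)
      subst this
      simp [wordCurve]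
    · rfl

theorem continuous_lieExp_smul (Y : GroupLieAlgebra 𝓘(ℝ, E) G) :
    Continuous fun t : ℝ => lieExp (t • Y) :=
  continuous_iff_continuousAt.2 fun t => (hasVel_lieExp Y t).continuousAt

theorem continuous_wordCurve : ∀ w : List (GroupLieAlgebra 𝓘(ℝ, E) G), Continuous (wordCurve w)
  | [] => continuous_const
  | Y :: w => by
    have : ContinuousMul G := continuousMul_of_contMDiffMul 𝓘(ℝ, E) ∞
    refine Continuous.if_le (continuous_lieExp_smul Y) (continuous_const.mul
      ((continuous_wordCurve w).comp (continuous_id.sub continuous_const))) continuous_id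
      continuous_const fun t ht => ?_
    have ht : t = 1 := ht
    simp [ht, wordCurve_zero]

omit [LieGroup 𝓘(ℝ, E) ∞ G] [FiniteDimensional ℝ E] [T2Space G] in
theorem wordVel_mem : ∀ (w : List (GroupLieAlgebra 𝓘(ℝ, E) G)) (t : ℝ), wordVel w t ∈ 0 :: w
  | [], _ => by simp [wordVel]
  | Y :: w, t => by
    have := wordVel_mem w (t - 1)
    rw [wordVel]
    split_ifs
    · simp
    · rcases List.mem_cons.1 this with h | h
      · rw [h]; simp
      · exact List.mem_cons_of_mem _ (List.mem_cons_of_mem _ h)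

omit [LieGroup 𝓘(ℝ, E) ∞ G] [FiniteDimensional ℝ E] [T2Space G] in
theorem HasVel.comp_sub_one {c : ℝ → G} {v : E} {t : ℝ} (hc : HasVel c v (t - 1)) :
    HasVel (fun s => c (s - 1)) v t :=
  (HasVel.comp (b := fun s => s - 1) hc ((hasDerivAt_id t).sub_const 1)).congr_vel (one_smul ℝ v)

theorem exists_right_vel_wordCurve : ∀ (w : List (GroupLieAlgebra 𝓘(ℝ, E) G)) (t : ℝ),
    ∃ c : ℝ → G, HasVel (E := E) c (wordVel w t) t ∧ wordCurve w =ᶠ[𝓝[≥] t] c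
  | [], t => ⟨fun _ => 1, hasVel_const 1 t, Filter.EventuallyEq.rfl⟩
  | Y :: w, t => by
    rcases lt_or_ge t 1 with ht | ht
    · refine ⟨fun s => lieExp (s • Y), by simpa [wordVel, ht] using hasVel_lieExp Y t, ?_⟩
      filter_upwards [mem_nhdsWithin_of_mem_nhds (Iio_mem_nhds ht)] with s hs
      simp [wordCurve, (show s < 1 from hs).le]
    · obtain ⟨c, hc, hcw⟩ := exists_right_vel_wordCurve w (t - 1)
      refine ⟨fun s => lieExp Y * c (s - 1), ?_, ?_⟩
      · simp only [wordVel, ht.not_gt, if_false]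
        exact (HasVel.comp_sub_one hc).const_mul _
      · have h1 : Filter.Tendsto (fun s : ℝ => s - 1) (𝓝[≥] t) (𝓝[≥] (t - 1)) :=
          tendsto_nhdsWithin_iff.2 ⟨((continuous_id.sub continuous_const).tendsto t).mono_left
            nhdsWithin_le_nhds, by
              filter_upwards [self_mem_nhdsWithin] with s hs
              exact sub_le_sub_right (show t ≤ s from hs) 1⟩
        filter_upwards [h1.eventually hcw, self_mem_nhdsWithin] with s hs hs'
        rw [← hs, wordCurve]
        split_ifs with h1
        · have : s = 1 := le_antisymm h1 (ht.trans hs')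
          simp [this, wordCurve_zero]
        · rfl

theorem hasVel_wordCurve (w : List (GroupLieAlgebra 𝓘(ℝ, E) G)) :
    ∀ t : ℝ, (∀ n : ℕ, t ≠ n) → HasVel (E := E) (wordCurve w) (wordVel w t) t := by
  induction w with
  | nil => exact fun t _ => hasVel_const 1 t
  | cons Y w ih =>
    intro t ht
    have ht1 : t ≠ 1 := by simpa using ht 1
    rcases lt_or_gt_of_ne ht1 with h | h
    · have h0 : HasVel (E := E) (fun s => lieExp (s • Y)) (wordVel (Y :: w) t) t := by
        simpa [wordVel, h] using hasVel_lieExp Y t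
      refine h0.congr ?_
      filter_upwards [Iio_mem_nhds h] with s hs
      simp [wordCurve, (show s < 1 from hs).le]
    · have h0 := ih (t - 1) fun n hn => ht (n + 1) (by push_cast; linarith)
      have h1 : HasVel (E := E) (fun s => lieExp Y * wordCurve w (s - 1)) (wordVel (Y :: w) t) t := by
        simp only [wordVel, h.not_gt, if_false]
        exact (HasVel.comp_sub_one h0).const_mul _
      refine h1.congr ?_
      filter_upwards [Ioi_mem_nhds h] with s hs
      simp [wordCurve, not_le.2 (show 1 < s from hs)]

end Curves

/-! ### Strictly convex norms -/

/-- For a strictly convex norm, equality in the triangle inequality forces the vectors to be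
positively proportional. -/
theorem smul_eq_smul_of_map_add_eq {V : Type*} [AddCommGroup V] [Module ℝ V] (p : Seminorm ℝ V)
    (hp : ∀ X Y, p X = 1 → p Y = 1 → p (X + Y) = 2 → X = Y) {A B : V} (hA : 0 < p A) (hB : 0 < p B)
    (h : p (A + B) = p A + p B) : (p A)⁻¹ • A = (p B)⁻¹ • B := by
  wlog hAB : p A ≤ p B generalizing A B
  · exact (this hB hA (by rw [add_comm, h, add_comm]) (le_of_not_ge hAB)).symm
  have h1 : ∀ {X}, 0 < p X → p ((p X)⁻¹ • X) = 1 := fun {X} hX => by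
    rw [map_smul_eq_mul, Real.norm_of_nonneg (inv_nonneg.2 hX.le), inv_mul_cancel₀ hX.ne']
  refine hp _ _ (h1 hA) (h1 hB) (le_antisymm ?_ ?_)
  · refine (map_add_le_add p _ _).trans ?_
    rw [h1 hA, h1 hB]
    norm_num
  · have e : (p A)⁻¹ • (A + B) =
        ((p A)⁻¹ • A + (p B)⁻¹ • B) + ((p A)⁻¹ - (p B)⁻¹) • B := by
      rw [smul_add, sub_smul]
      abel
    have h2 := map_add_le_add p ((p A)⁻¹ • A + (p B)⁻¹ • B) (((p A)⁻¹ - (p B)⁻¹) • B)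
    rw [← e, map_smul_eq_mul, map_smul_eq_mul, Real.norm_of_nonneg (inv_nonneg.2 hA.le),
      Real.norm_of_nonneg (sub_nonneg.2 (inv_anti₀ hA hAB)), h] at h2
    have h3 : (p A)⁻¹ * (p A + p B) - ((p A)⁻¹ - (p B)⁻¹) * p B = 2 := by
      field_simp
      ring
    linarith

/-! ### Lengths of word curves and of corners -/

namespace CarnotStructure

variable {E : Type*} [NormedAddCommGroup E] [NormedSpace ℝ E]
  {G : Type*} [TopologicalSpace G] [ChartedSpace E G] [Group G]

theorem norm_sub_lt {C : CarnotStructure E G} (hC : C.IsStrictlyConvex) {x₁ x₂ : C.layer 1}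
    (h : LinearIndependent ℝ ![x₁, x₂]) : C.norm (x₂ - x₁) < C.norm x₁ + C.norm x₂ := by
  have hpos : ∀ X : C.layer 1, X ≠ 0 → 0 < C.norm X := fun X hX =>
    lt_of_le_of_ne (apply_nonneg _ _) fun h0 => hX (C.eq_zero_of_norm_eq_zero X h0.symm)
  have h1 : x₁ ≠ 0 := h.ne_zero 0
  have h2 : x₂ ≠ 0 := h.ne_zero 1
  refine lt_of_le_of_ne ((map_sub_le_add C.norm x₂ x₁).trans_eq (add_comm _ _)) fun heq => ?_
  have h3 := smul_eq_smul_of_map_add_eq C.norm hC (A := x₂) (B := -x₁) (hpos _ h2)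
    (by rw [map_neg_eq_map]; exact hpos _ h1)
    (by rw [← sub_eq_add_neg, heq, map_neg_eq_map, add_comm])
  rw [LinearIndependent.pair_iff] at h
  have h4 := (h ((C.norm (-x₁))⁻¹) ((C.norm x₂)⁻¹) (by rw [h3, smul_neg, add_neg_cancel])).2
  exact (inv_ne_zero (hpos _ h2).ne') h4

/-- The stratification that is part of a Carnot structure. -/
def toStratification [CompleteSpace E] [LieGroup 𝓘(ℝ, E) (minSmoothness ℝ 3) G]
    (C : CarnotStructure E G) : Stratification (GroupLieAlgebra 𝓘(ℝ, E) G) where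
  step := C.step
  layer := C.layer
  layer_zero := C.layer_zero
  layer_of_step_lt := C.layer_of_step_lt
  isInternal := C.isInternal
  layer_succ := C.layer_succ

variable [LieGroup 𝓘(ℝ, E) ∞ G] (C : CarnotStructure E G)

theorem mulInvariantVectorField_injective (g : G) {X Y : GroupLieAlgebra 𝓘(ℝ, E) G}
    (h : mulInvariantVectorField X g = mulInvariantVectorField Y g) : X = Y :=
  dL_injective (E := E) g h

theorem mem_layer_of_mem_distribution {X : GroupLieAlgebra 𝓘(ℝ, E) G} {g : G}
    (h : mulInvariantVectorField X g ∈ C.distribution g) : X ∈ C.layer 1 := by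
  obtain ⟨Y, hY⟩ := h
  exact mulInvariantVectorField_injective g hY ▸ Y.2

theorem speed_mulInvariantVectorField (X : C.layer 1) (g : G) :
    C.speed g (mulInvariantVectorField (X : GroupLieAlgebra 𝓘(ℝ, E) G) g) =
      ENNReal.ofReal (C.norm X) := by
  refine le_antisymm (iInf_le_of_le X (iInf_le_of_le rfl le_rfl)) (le_iInf₂ fun Y hY => ?_)
  rw [Subtype.ext (mulInvariantVectorField_injective g hY)]

omit [LieGroup 𝓘(ℝ, E) ∞ G] in
theorem mfderiv_eq_of_hasVel {c : ℝ → G} {v : GroupLieAlgebra 𝓘(ℝ, E) G} {t : ℝ}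
    (h : HasVel (E := E) c v t) :
    mfderiv 𝓘(ℝ, ℝ) 𝓘(ℝ, E) c t 1 = mulInvariantVectorField v (c t) := by
  have h1 := HasMFDerivAt.mfderiv h
  have h2 : (mfderiv 𝓘(ℝ, ℝ) 𝓘(ℝ, E) c t : ℝ →L[ℝ] E) 1 = (1 : ℝ) • dL E (c t) v :=
    congrArg (fun T : ℝ →L[ℝ] E => T 1) h1
  exact h2.trans (one_smul ℝ (dL E (c t) v))

/-- An upper bound for the speed of `wordCurve` whose integral is the length of the word. -/
def wordDensity : List (C.layer 1) → ℝ → ℝ≥0∞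
  | [], _ => 0
  | X :: w, t => (Ico (0 : ℝ) 1).indicator (fun _ => ENNReal.ofReal (C.norm X)) t +
      wordDensity w (t - 1)

omit [LieGroup 𝓘(ℝ, E) ∞ G] in
theorem lintegral_wordDensity (w : List (C.layer 1)) :
    ∫⁻ t, C.wordDensity w t = ENNReal.ofReal (wordCost C.norm w) := by
  induction w with
  | nil => simp [wordDensity]
  | cons X w ih =>
    simp only [wordDensity]
    rw [lintegral_add_left (measurable_const.indicator measurableSet_Ico),
      lintegral_sub_right_eq_self (C.wordDensity w) 1, ih, lintegral_indicator measurableSet_Ico,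
      setLIntegral_const, wordCost_cons, ENNReal.ofReal_add (apply_nonneg _ _)
      (wordCost_nonneg C.norm w)]
    simp

variable [FiniteDimensional ℝ E] [T2Space G]

omit [LieGroup 𝓘(ℝ, E) ∞ G] [FiniteDimensional ℝ E] [T2Space G] in
theorem exists_wordVel_eq : ∀ (w : List (C.layer 1)) (t : ℝ), 0 ≤ t →
    ∃ X : C.layer 1, wordVel (w.map fun X : C.layer 1 => (X : GroupLieAlgebra 𝓘(ℝ, E) G)) t = X ∧
      ENNReal.ofReal (C.norm X) ≤ C.wordDensity w t
  | [], t, _ => ⟨0, rfl, by simp⟩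
  | X :: w, t, ht => by
    rcases lt_or_ge t 1 with h | h
    · refine ⟨X, by simp [wordVel, h], ?_⟩
      rw [wordDensity, indicator_of_mem (show t ∈ Ico (0 : ℝ) 1 from ⟨ht, h⟩)]
      exact le_self_add
    · obtain ⟨Y, hY, hYw⟩ := exists_wordVel_eq w (t - 1) (by linarith)
      refine ⟨Y, by simpa [wordVel, h.not_gt] using hY, hYw.trans ?_⟩
      rw [wordDensity]
      exact le_add_self

/-- The distance between points joined by a horizontal word is at most the length of the word. -/
theorem ccDist_le_wordCost [CompleteSpace E] [LieGroup 𝓘(ℝ, E) (minSmoothness ℝ 3) G]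
    (g h : G) (w : List (C.layer 1))
    (hw : g * (w.map fun X : C.layer 1 => lieExp (X : GroupLieAlgebra 𝓘(ℝ, E) G)).prod = h) :
    C.ccDist g h ≤ ENNReal.ofReal (wordCost C.norm w) := by
  have : ContinuousMul G := continuousMul_of_contMDiffMul 𝓘(ℝ, E) ∞
  set w' := w.map fun X : C.layer 1 => (X : GroupLieAlgebra 𝓘(ℝ, E) G) with hw'
  set γ : ℝ → G := fun t => g * wordCurve w' t with hγ
  have h0 : γ 0 = g := by simp [hγ, wordCurve_zero]
  have h1 : γ w'.length = h := by
    rw [hγ, ← hw]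
    simp only [wordCurve_length, hw', List.map_map, Function.comp_def]
  have hac : AbsCont E γ 0 w'.length := by
    refine absCont_of_right_vel (E := E) (continuous_const.mul (continuous_wordCurve w')) (0 :: w')
      (fun t => ?_) _ _
    obtain ⟨c, hc, hcw⟩ := exists_right_vel_wordCurve w' t
    exact ⟨wordVel w' t, wordVel_mem w' t, fun s => g * c s, hc.const_mul g,
      hcw.fun_comp (fun x => g * x)⟩
  have hae : ∀ᵐ t ∂(volume.restrict (Icc (0 : ℝ) w'.length)),
      HasVel (E := E) γ (wordVel w' t) t ∧ 0 ≤ t := by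
    have hn : ∀ᵐ t ∂(volume : Measure ℝ), t ∉ range (fun n : ℕ => (n : ℝ)) :=
      (countable_range _).ae_notMem _
    filter_upwards [ae_restrict_of_ae hn, ae_restrict_mem measurableSet_Icc] with t ht ht'
    exact ⟨(hasVel_wordCurve w' t fun n hn => ht ⟨n, hn.symm⟩).const_mul g, ht'.1⟩
  have hle : C.ccDist g h ≤ C.length γ 0 w'.length := by
    rw [ccDist]
    exact iInf_le_of_le γ <| iInf_le_of_le 0 <| iInf_le_of_le (w'.length : ℝ) <|
      iInf_le_of_le (Nat.cast_nonneg _) <| iInf_le_of_le h0 <| iInf_le_of_le h1 le_rfl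
  refine hle.trans ?_
  have hdist : ∀ᵐ t ∂(volume.restrict (Icc (0 : ℝ) w'.length)),
      mfderiv 𝓘(ℝ, ℝ) 𝓘(ℝ, E) γ t 1 ∈ C.distribution (γ t) := by
    refine hae.mono fun t ht => ?_
    obtain ⟨X, hX, -⟩ := C.exists_wordVel_eq w t ht.2
    rw [mfderiv_eq_of_hasVel ht.1, hX]
    exact ⟨X, rfl⟩
  rw [length, if_pos ⟨hac, hdist⟩, ← lintegral_wordDensity]
  refine (lintegral_mono_ae (hae.mono fun t ht => ?_)).trans (setLIntegral_le_lintegral _ _)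
  obtain ⟨X, hX, hXw⟩ := C.exists_wordVel_eq w t ht.2
  rw [mfderiv_eq_of_hasVel ht.1, hX, speed_mulInvariantVectorField]
  exact hXw

/-- A corner of finite length has horizontal directions, and its length is at least the sum of
their norms. -/
theorem mem_layer_and_le_length {γ : ℝ → G} {X₁ X₂ : GroupLieAlgebra 𝓘(ℝ, E) G}
    (h₁ : ∀ t ∈ Icc (-1 : ℝ) 0, γ t = lieExp ((-t) • X₁))
    (h₂ : ∀ t ∈ Ioc (0 : ℝ) 1, γ t = lieExp (t • X₂)) (hfin : C.length γ (-1) 1 ≠ ⊤) :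
    ∃ x₁ x₂ : C.layer 1, (x₁ : GroupLieAlgebra 𝓘(ℝ, E) G) = X₁ ∧
      (x₂ : GroupLieAlgebra 𝓘(ℝ, E) G) = X₂ ∧
      ENNReal.ofReal (C.norm x₁ + C.norm x₂) ≤ C.length γ (-1) 1 := by
  have hv₁ : ∀ t ∈ Ioo (-1 : ℝ) 0, HasVel (E := E) γ (-X₁) t := by
    intro t ht
    refine (hasVel_lieExp (-X₁) t).congr ?_
    filter_upwards [Ioo_mem_nhds ht.1 ht.2] with s hs
    rw [h₁ s ⟨hs.1.le, hs.2.le⟩, neg_smul, smul_neg]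
  have hv₂ : ∀ t ∈ Ioo (0 : ℝ) 1, HasVel (E := E) γ X₂ t := by
    intro t ht
    refine (hasVel_lieExp X₂ t).congr ?_
    filter_upwards [Ioo_mem_nhds ht.1 ht.2] with s hs
    rw [h₂ s ⟨hs.1, hs.2.le⟩]
  have hcond : AbsCont E γ (-1) 1 ∧ ∀ᵐ t ∂(volume.restrict (Icc (-1 : ℝ) 1)),
      mfderiv 𝓘(ℝ, ℝ) 𝓘(ℝ, E) γ t 1 ∈ C.distribution (γ t) := by
    by_contra hcon
    exact hfin (if_neg hcon)
  have hex : ∀ {a b : ℝ}, a < b → Ioo a b ⊆ Icc (-1) 1 →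
      ∃ t ∈ Ioo a b, mfderiv 𝓘(ℝ, ℝ) 𝓘(ℝ, E) γ t 1 ∈ C.distribution (γ t) := by
    intro a b hab hsub
    have h := ae_restrict_of_ae_restrict_of_subset hsub hcond.2
    rw [ae_restrict_iff' measurableSet_Ioo] at h
    by_contra! hcon
    have h0 : volume (Ioo a b) = 0 := by
      rw [ae_iff] at h
      refine measure_mono_null (fun t ht => ?_) h
      exact fun h' => hcon t ht (h' ht)
    rw [Real.volume_Ioo, ENNReal.ofReal_eq_zero] at h0
    linarith
  have hs₁ : Ioo (-1 : ℝ) 0 ⊆ Icc (-1) 1 := fun t ht => ⟨ht.1.le, by linarith [ht.2]⟩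
  have hs₂ : Ioo (0 : ℝ) 1 ⊆ Icc (-1) 1 := fun t ht => ⟨by linarith [ht.1], ht.2.le⟩
  obtain ⟨t₁, ht₁, hd₁⟩ := hex (by norm_num) hs₁
  obtain ⟨t₂, ht₂, hd₂⟩ := hex (by norm_num) hs₂
  rw [mfderiv_eq_of_hasVel (hv₁ t₁ ht₁)] at hd₁
  rw [mfderiv_eq_of_hasVel (hv₂ t₂ ht₂)] at hd₂
  have hX₁ : X₁ ∈ C.layer 1 := neg_mem_iff.1 (C.mem_layer_of_mem_distribution hd₁)
  have hX₂ : X₂ ∈ C.layer 1 := C.mem_layer_of_mem_distribution hd₂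
  refine ⟨⟨X₁, hX₁⟩, ⟨X₂, hX₂⟩, rfl, rfl, ?_⟩
  rw [length, if_pos hcond]
  have hdisj : Disjoint (Ioo (-1 : ℝ) 0) (Ioo 0 1) :=
    disjoint_left.2 fun t h h' => lt_asymm h.2 h'.1
  refine le_trans ?_ (lintegral_mono_set (union_subset hs₁ hs₂))
  rw [lintegral_union measurableSet_Ioo hdisj, ENNReal.ofReal_add (apply_nonneg _ _)
    (apply_nonneg _ _)]
  refine add_le_add (le_of_eq ?_) (le_of_eq ?_)
  · rw [setLIntegral_congr_fun (g := fun _ => ENNReal.ofReal (C.norm ⟨X₁, hX₁⟩)) measurableSet_Ioo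
      fun t ht => ?_]
    · simp
    · have e : (-X₁ : GroupLieAlgebra 𝓘(ℝ, E) G) = ((-⟨X₁, hX₁⟩ : C.layer 1) :
        GroupLieAlgebra 𝓘(ℝ, E) G) := rfl
      simp only [mfderiv_eq_of_hasVel (hv₁ t ht)]
      rw [e, speed_mulInvariantVectorField, map_neg_eq_map]
  · rw [setLIntegral_congr_fun (g := fun _ => ENNReal.ofReal (C.norm ⟨X₂, hX₂⟩)) measurableSet_Ioo
      fun t ht => ?_]
    · simp
    · simp only [mfderiv_eq_of_hasVel (hv₂ t ht)]
      exact C.speed_mulInvariantVectorField ⟨X₂, hX₂⟩ (γ t)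

end CarnotStructure

/-! ### Corners are not length minimizing -/

namespace CarnotStructure

variable {E : Type*} [NormedAddCommGroup E] [NormedSpace ℝ E]
  {G : Type*} [TopologicalSpace G] [ChartedSpace E G] [Group G] [LieGroup 𝓘(ℝ, E) ∞ G]
  [CompleteSpace E] [LieGroup 𝓘(ℝ, E) (minSmoothness ℝ 3) G] [FiniteDimensional ℝ E] [T2Space G]
  (C : CarnotStructure E G)

/-- Exponentials are joined by horizontal curves of finite length. -/
theorem ccDist_lieExp_ne_top (X₁ X₂ : GroupLieAlgebra 𝓘(ℝ, E) G) :
    C.ccDist (lieExp X₁) (lieExp X₂) ≠ ⊤ := by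
  obtain ⟨w, hw⟩ := exists_word_of_mem_horizontalSubgroup (S := C.toStratification)
    (mul_mem (inv_mem (lieExp_mem_horizontalSubgroup X₁)) (lieExp_mem_horizontalSubgroup X₂))
  refine ne_top_of_le_ne_top ENNReal.ofReal_ne_top (C.ccDist_le_wordCost _ _ w ?_)
  exact (congrArg (lieExp X₁ * ·) hw).trans (mul_inv_cancel_left _ _)

/-- The endpoints of a corner with horizontal directions are joined by a word that is shorter than
the corner. -/
theorem ccDist_lieExp_lt (hC : C.IsStrictlyConvex) {x₁ x₂ : C.layer 1}
    (h : LinearIndependent ℝ ![x₁, x₂]) :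
    C.ccDist (lieExp (x₁ : GroupLieAlgebra 𝓘(ℝ, E) G)) (lieExp (x₂ : GroupLieAlgebra 𝓘(ℝ, E) G)) <
      ENNReal.ofReal (C.norm x₁ + C.norm x₂) := by
  set S := C.toStratification with hS
  -- the letters of the words are taken from the plane spanned by the two directions
  set P : Submodule ℝ (C.layer 1) := Submodule.span ℝ {x₁, x₂} with hP
  let ρ : P →ₗ[ℝ] Module.End ℝ (GroupLieAlgebra 𝓘(ℝ, E) G × ℝ) := S.firstAd ∘ₗ P.subtype
  have hρ : LinearMap.range ρ ≤ S.endFiltration.homog 1 :=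
    (LinearMap.range_comp_le_range _ _).trans Stratification.range_firstAd_le
  let y₁ : P := ⟨x₁, Submodule.subset_span (by simp)⟩
  let y₂ : P := ⟨x₂, Submodule.subset_span (by simp)⟩
  have hspan : Submodule.span ℝ {y₁, y₂} = ⊤ := by
    refine Submodule.map_injective_of_injective P.injective_subtype ?_
    rw [Submodule.map_span, Submodule.map_top, Submodule.range_subtype, image_pair]
    rfl
  obtain ⟨w, hw, hw1⟩ := exists_shorter_word hρ (C.norm.comp P.subtype) hspan
    (C.norm_sub_lt hC h)
  have hcost : wordCost C.norm (w.map P.subtype) = wordCost (C.norm.comp P.subtype) w := by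
    simp [wordCost, Function.comp_def]
  have hone := prod_lieExp_eq_one (S := S)
    (([y₁] ++ w ++ [-y₂]).map fun y : P => (1, ((y : C.layer 1) : GroupLieAlgebra 𝓘(ℝ, E) G))) (by
      intro p hp
      obtain ⟨y, -, rfl⟩ := List.mem_map.1 hp
      exact (y : C.layer 1).2) (by
      rw [List.map_map]
      exact hw1)
  refine (C.ccDist_le_wordCost _ _ (w.map P.subtype) ?_).trans_lt ?_
  · simp only [List.map_map, List.map_append, List.map_cons, List.map_nil, List.prod_append,
      List.prod_singleton, Function.comp_def, Submodule.coe_neg, lieExp_neg] at hone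
    rw [List.map_map]
    exact mul_inv_eq_one.1 hone
  · rw [hcost]
    exact (ENNReal.ofReal_lt_ofReal_iff_of_nonneg (wordCost_nonneg _ _)).2 hw

end CarnotStructure

end Carnot

end

theorem theorem2 {E : Type*} [NormedAddCommGroup E] [NormedSpace ℝ E] [FiniteDimensional ℝ E]
    {G : Type*} [TopologicalSpace G] [ChartedSpace E G] [Group G] [LieGroup 𝓘(ℝ, E) ∞ G]
    [T2Space G] [SimplyConnectedSpace G]
    (C : Carnot.CarnotStructure E G) (hC : C.IsStrictlyConvex)
    (γ : ℝ → G) (hγ : Carnot.IsCorner (E := E) γ) :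
    ¬ C.IsLengthMinimizing γ (-1) 1 := by
  -- instances for the Lie algebra structure on the tangent space at the identity
  have : CompleteSpace E := FiniteDimensional.complete ℝ E
  have : LieGroup 𝓘(ℝ, E) (minSmoothness ℝ 3) G :=
    LieGroup.of_le (n := ∞) (by
      rw [minSmoothness_of_isRCLikeNormedField]
      exact ENat.LEInfty.out)
  obtain ⟨X₁, X₂, hli, h₁, h₂⟩ := hγ
  have e₁ : γ (-1) = Carnot.lieExp X₁ := by
    rw [h₁ (-1) ⟨le_rfl, by norm_num⟩, neg_neg, one_smul]
  have e₂ : γ 1 = Carnot.lieExp X₂ := by rw [h₂ 1 ⟨one_pos, le_rfl⟩, one_smul]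
  intro hmin
  rw [Carnot.CarnotStructure.IsLengthMinimizing, e₁, e₂] at hmin
  have hfin : C.length γ (-1) 1 ≠ ⊤ := by
    rw [hmin]
    exact C.ccDist_lieExp_ne_top X₁ X₂
  obtain ⟨x₁, x₂, rfl, rfl, hle⟩ := C.mem_layer_and_le_length h₁ h₂ hfin
  have hli' : LinearIndependent ℝ ![x₁, x₂] := by
    rw [LinearIndependent.pair_iff] at hli ⊢
    intro a b hab
    exact hli a b (congrArg (Submodule.subtype _) hab)
  rw [hmin] at hle
  exact (C.ccDist_lieExp_lt hC hli').not_ge hle
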